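/- Let $M$ and $N$ be finite sets with $|M| = m$ and $|N| = n$, let $d : M \to \mathbb{N} = \{0,1,2,\dots\}$ be a function, and suppose that $n = 1 + \sum_{\mu \in M} d(\mu)$. Let $P_d \subset \mathbb{R}^{M \times N}$ be the transportation polytope with supplies $1 + m\,d(\mu)$ for $\mu \in M$ and all demands equal to $m$, that is, $$P_d = \Big\{ x \in \mathbb{R}_{\ge 0}^{M \times N} \;:\; \sum_{\nu \in N} x_{\mu,\nu} = 1 + m\,d(\mu) \text{ for all } \mu \in M, \quad \sum_{\mu \in M} x_{\mu,\nu} = m \text{ for all } \nu \in N \Big\}.$$ Then the numbers $f_0(P_d)$ of vertices ($0$-dimensional faces) and $f_1(P_d)$ of edges ($1$-dimensional faces, where $P_d$ counts as a face of itself) of $P_d$ are finite and are given by $$f_0(P_d) = \frac{(n-1)!\, n^{m-1}}{\prod_{\mu \in M} d(\mu)!} \qquad\text{and}\qquad f_1(P_d) = \frac{(m-1)(n-1)\,(n-1)!\, n^{m-1}}{2 \prod_{\mu \in M} d(\mu)!}.$$ -/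

import Mathlib

/-- The transportation polytope in `ℝ^(M × N)` with supply function `a` and demand function `b`. -/
def transportationPolytope {M N : Type*} [Fintype M] [Fintype N] (a : M → ℝ) (b : N → ℝ) :
    Set (M × N → ℝ) :=
  {x | (∀ e, 0 ≤ x e) ∧ (∀ μ, ∑ ν, x (μ, ν) = a μ) ∧ (∀ ν, ∑ μ, x (μ, ν) = b ν)}

/-- The polytope `P_d` of a degree function `d : M → ℕ`: the transportation polytope in which
the source `μ` supplies `1 + m * d μ` and every sink demands `m`, where `m = |M|`. -/
def degreePolytope {M : Type*} [Fintype M] (N : Type*) [Fintype N] (d : M → ℕ) :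
    Set (M × N → ℝ) :=
  transportationPolytope (fun μ => 1 + (Fintype.card M : ℝ) * (d μ : ℝ))
    (fun _ => (Fintype.card M : ℝ))

/-- The `k`-dimensional faces of a convex polytope `P`: the nonempty subsets of `P` on which some
linear functional attains its maximum over `P` (the zero functional gives `P` itself), whose affine
hull has dimension `k`. Vertices are the case `k = 0` and edges the case `k = 1`. -/
def facesOfDim {E : Type*} [AddCommGroup E] [Module ℝ E] [TopologicalSpace E]
    (P : Set E) (k : ℕ) : Set (Set E) :=
  {F | F.Nonempty ∧ IsExposed ℝ P F ∧ Module.finrank ℝ (vectorSpan ℝ F) = k}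

/-! A point of `P_d` is a flow on the complete bipartite graph on `M` and `N`, and the vertices turn
out to correspond to the spanning trees in which each `μ` has degree `d μ + 1`.

A set with source part A and sink part C has net supply |A| + m(∑_A d - |C|). This vanishes only if
m divides |A|, that is, only for the empty set and the whole vertex set. Hence the support of every
point is connected (`bipartiteConnected_support`), and a point is a vertex exactly when its support
is a spanning tree T. Cutting T at an edge shows that the flow through this edge is |S| + m ∑_S (d +
1 - deg_T), where S is the nonempty set of sources on one side
(`BipartiteConnected.exists_flow_formula`). If the degrees are d + 1, this is |S| > 0 and T supports
a vertex. Conversely, positivity on T forces these degrees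
(`card_filter_fst_eq_of_mem_degreePolytope`).

The trees are counted by a weighted matrix-tree theorem: with weight X_μ on each edge at `μ`, n
times the tree polynomial is n^m (∑ X)^(n-1) ∏ X, and the coefficient of ∏ X_μ^(d μ + 1) is
multinomial (`card_degreeTrees`).

Every vertex has m + n - 1 nonzero coordinates, hence (m-1)(n-1) zeros, which is the dimension of
the space of circulations. So each vertex lies on (m-1)(n-1) edges, each edge has two vertices, and
double counting gives f_1 (`two_mul_ncard_edges`). -/

/-! ### Connected multigraphs, flows and tree cuts. -/

/-- Connectedness of the multigraph with vertex set `V` and edges `h e — t e` for `e : E`: every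
set of vertices that no edge leaves is trivial. -/
def EdgeConnected {V E : Type*} (h t : E → V) : Prop :=
  ∀ s : Set V, (∀ e, h e ∈ s ↔ t e ∈ s) → s = ∅ ∨ s = Set.univ

theorem EdgeConnected.apply_eq {V E α : Type*} {h t : E → V} (hc : EdgeConnected h t)
    {φ : V → α} (hφ : ∀ e, φ (h e) = φ (t e)) (v w : V) : φ v = φ w := by
  rcases hc {u | φ u = φ w} (fun e => by simp [hφ e]) with h0 | h0
  · exact absurd (show w ∈ {u | φ u = φ w} from rfl) (by simp [h0])
  · exact (h0 ▸ Set.mem_univ v : v ∈ {u | φ u = φ w})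

open Classical in
/-- The boundary operator of the multigraph with edges `h e — t e`. -/
noncomputable def boundary {V E : Type*} [Fintype E] (h t : E → V) : (E → ℝ) →ₗ[ℝ] (V → ℝ) where
  toFun x v := ∑ e, x e * ((if h e = v then 1 else 0) - (if t e = v then 1 else 0))
  map_add' x y := by ext v; simp [add_mul, Finset.sum_add_distrib]
  map_smul' c x := by ext v; simp [mul_assoc, Finset.mul_sum]

open Classical in
theorem boundary_apply {V E : Type*} [Fintype E] (h t : E → V) (x : E → ℝ) (v : V) :
    boundary h t x v = ∑ e, x e * ((if h e = v then 1 else 0) - (if t e = v then 1 else 0)) := rfl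

/-- Summation by parts. With `φ` the indicator of a vertex set it expresses the net supply of the
set as the flow across its cut. -/
theorem sum_mul_boundary {V E : Type*} [Fintype V] [Fintype E] (h t : E → V) (φ : V → ℝ)
    (x : E → ℝ) : ∑ v, φ v * boundary h t x v = ∑ e, x e * (φ (h e) - φ (t e)) := by
  classical
  simp only [boundary_apply, Finset.mul_sum]
  rw [Finset.sum_comm]
  refine Finset.sum_congr rfl fun e _ => ?_
  calc _ = x e * ∑ v, φ v * ((if h e = v then 1 else 0) - (if t e = v then 1 else 0)) := by
        rw [Finset.mul_sum]; exact Finset.sum_congr rfl fun v _ => by ring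
    _ = _ := by simp [mul_sub]

theorem sum_boundary {V E : Type*} [Fintype V] [Fintype E] (h t : E → V) (x : E → ℝ) :
    ∑ v, boundary h t x v = 0 := by
  simpa using sum_mul_boundary h t (fun _ => 1) x

/-- By duality: a functional that kills the range of the boundary takes equal values at the two ends
of every edge, so by connectedness it is a multiple of the coordinate sum and kills `b` too. -/
theorem EdgeConnected.exists_boundary_eq {V E : Type*} [Fintype V] [Fintype E] {h t : E → V}
    (hc : EdgeConnected h t) {b : V → ℝ} (hb : ∑ v, b v = 0) : ∃ x, boundary h t x = b := by
  classical
  by_contra hx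
  have hb' : b ∉ LinearMap.range (boundary h t) := by simpa [LinearMap.mem_range] using hx
  obtain ⟨f, hfb, hf⟩ := Submodule.exists_dual_map_eq_bot_of_notMem hb' inferInstance
  have hfe (y : V → ℝ) : f y = ∑ v, f (Pi.single v 1) * y v := by
    conv_lhs => rw [← Finset.univ_sum_single y, map_sum]
    refine Finset.sum_congr rfl fun v _ => ?_
    rw [mul_comm, ← smul_eq_mul, ← map_smul]
    congr 1
    ext w
    simp [Pi.single_apply]
  have hconst (e : E) : f (Pi.single (h e) 1) = f (Pi.single (t e) 1) := by
    have h0 : f (boundary h t (Pi.single e 1)) = 0 := by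
      have : f (boundary h t (Pi.single e 1)) ∈ (LinearMap.range (boundary h t)).map f :=
        Submodule.mem_map_of_mem ⟨_, rfl⟩
      simpa [hf] using this
    rw [hfe, sum_mul_boundary, Finset.sum_eq_single e] at h0
    · simpa [sub_eq_zero] using h0
    · intro e' _ he'
      simp [he']
    · simp
  apply hfb
  rw [hfe]
  rcases isEmpty_or_nonempty V with hV | ⟨⟨w⟩⟩
  · simp
  · have := hc.apply_eq (φ := fun v => f (Pi.single v 1)) hconst
    simp only [fun v => this v w, ← Finset.mul_sum, hb, mul_zero]

theorem EdgeConnected.finrank_ker_boundary {V E : Type*} [Fintype V] [Nonempty V] [Fintype E]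
    {h t : E → V} (hc : EdgeConnected h t) :
    Module.finrank ℝ (LinearMap.ker (boundary h t)) + Fintype.card V = Fintype.card E + 1 := by
  classical
  let σ : (V → ℝ) →ₗ[ℝ] ℝ := ∑ v, LinearMap.proj v
  have hσ (y : V → ℝ) : σ y = ∑ v, y v := by simp [σ]
  have hr : LinearMap.range (boundary h t) = LinearMap.ker σ := by
    ext b
    rw [LinearMap.mem_ker, hσ]
    constructor
    · rintro ⟨x, rfl⟩
      exact sum_boundary h t x
    · exact fun hb => hc.exists_boundary_eq hb
  have h1 := (boundary h t).finrank_range_add_finrank_ker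
  have h2 := σ.finrank_range_add_finrank_ker
  have h3 : LinearMap.range σ = ⊤ := by
    rw [LinearMap.range_eq_top]
    intro c
    exact ⟨Pi.single (Classical.arbitrary V) c, by simp [hσ]⟩
  rw [h3, finrank_top, Module.finrank_self, Module.finrank_fintype_fun_eq_card] at h2
  rw [hr, Module.finrank_fintype_fun_eq_card] at h1
  omega

theorem EdgeConnected.card_le {V E : Type*} [Fintype V] [Fintype E]
    {h t : E → V} (hc : EdgeConnected h t) : Fintype.card V ≤ Fintype.card E + 1 := by
  rcases isEmpty_or_nonempty V with hV | hV
  · simp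
  · have := hc.finrank_ker_boundary
    omega

theorem EdgeConnected.boundary_injective {V E : Type*} [Fintype V] [Fintype E]
    {h t : E → V} (hc : EdgeConnected h t) (hcard : Fintype.card E + 1 = Fintype.card V) :
    Function.Injective (boundary h t) := by
  have : Nonempty V := Fintype.card_pos_iff.1 (by omega)
  have := hc.finrank_ker_boundary
  exact LinearMap.ker_eq_bot.1 (Submodule.finrank_eq_zero.1 (by omega))

/-- If a set of vertices of a connected multigraph is left by a single edge only, then it spans a
connected multigraph. -/
theorem EdgeConnected.restrict {V E : Type*} {h t : E → V} (hc : EdgeConnected h t) {s : Set V}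
    {e₀ : E} (hs : ∀ e, e ≠ e₀ → (h e ∈ s ↔ t e ∈ s)) (h0 : ¬ (h e₀ ∈ s ↔ t e₀ ∈ s)) :
    EdgeConnected (V := s) (E := {e // e ≠ e₀ ∧ h e ∈ s}) (fun e => ⟨h e.1, e.2.2⟩)
      (fun e => ⟨t e.1, (hs _ e.2.1).1 e.2.2⟩) := by
  intro q hq
  -- A set closed under the inner edges that avoids both ends of `e₀` is closed in the whole graph.
  -- As only one end of `e₀` lies in `s`, this applies to `q` or to its complement.
  have key (q : Set s) (hq : ∀ e : {e // e ≠ e₀ ∧ h e ∈ s},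
      (⟨h e.1, e.2.2⟩ : s) ∈ q ↔ (⟨t e.1, (hs _ e.2.1).1 e.2.2⟩ : s) ∈ q)
      (h1 : h e₀ ∉ Subtype.val '' q) (h2 : t e₀ ∉ Subtype.val '' q) : q = ∅ := by
    have hq' (e : E) : h e ∈ Subtype.val '' q ↔ t e ∈ Subtype.val '' q := by
      rcases eq_or_ne e e₀ with rfl | he
      · simp only [h1, h2]
      · by_cases hes : h e ∈ s
        · have hes' := (hs e he).1 hes
          have := hq ⟨e, he, hes⟩
          simpa [hes, hes'] using this
        · have hes' := mt (hs e he).2 hes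
          simp [hes, hes']
    rcases hc _ hq' with h | h
    · simpa using h
    · exact absurd (h ▸ Set.mem_univ _) h1
  have hcompl (e : {e // e ≠ e₀ ∧ h e ∈ s}) :
      (⟨h e.1, e.2.2⟩ : s) ∈ qᶜ ↔ (⟨t e.1, (hs _ e.2.1).1 e.2.2⟩ : s) ∈ qᶜ := by
    simpa using not_congr (hq e)
  by_cases hh : h e₀ ∈ s
  · have ht : t e₀ ∉ s := fun ht => h0 (by simp [hh, ht])
    by_cases h1 : (⟨h e₀, hh⟩ : s) ∈ q
    · exact Or.inr (Set.compl_empty_iff.1 (key qᶜ hcompl (by simp [hh, h1]) (by simp [ht])))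
    · exact Or.inl (key q hq (by simp [hh, h1]) (by simp [ht]))
  · have ht : t e₀ ∈ s := by by_contra ht; exact h0 (by simp [hh, ht])
    by_cases h1 : (⟨t e₀, ht⟩ : s) ∈ q
    · exact Or.inr (Set.compl_empty_iff.1 (key qᶜ hcompl (by simp [hh]) (by simp [ht, h1])))
    · exact Or.inl (key q hq (by simp [hh]) (by simp [ht, h1]))

open Classical in
/-- Removing an edge from a tree splits it into two trees. -/
theorem EdgeConnected.exists_cut {V E : Type*} [Fintype V] [Fintype E] {h t : E → V}
    (hc : EdgeConnected h t) (hcard : Fintype.card E + 1 = Fintype.card V) (e₀ : E) :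
    ∃ s : Finset V, (∀ e, e ≠ e₀ → (h e ∈ s ↔ t e ∈ s)) ∧ h e₀ ∈ s ∧ t e₀ ∉ s ∧
      (Finset.univ.filter fun e => h e ∈ s).card = s.card := by
  have hex : ∃ s : Finset V, (∀ e, e ≠ e₀ → (h e ∈ s ↔ t e ∈ s)) ∧ h e₀ ∈ s ∧ t e₀ ∉ s := by
    -- Only |V| - 2 edges remain, too few to connect the vertices.
    have hn : ¬ EdgeConnected (fun e : {e // e ≠ e₀} => h e.1) (fun e => t e.1) := by
      intro hc'
      have := hc'.card_le
      have h2 := Fintype.card_subtype_compl (fun e => e = e₀)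
      have h3 : Fintype.card {e : E // ¬ e = e₀} = Fintype.card {e : E // e ≠ e₀} := rfl
      simp only [Fintype.card_subtype_eq] at h2
      have : 0 < Fintype.card E := Fintype.card_pos_iff.2 ⟨e₀⟩
      omega
    simp only [EdgeConnected] at hn
    push Not at hn
    obtain ⟨s, hs, hs1, hs2⟩ := hn
    have hs' (e : E) (he : e ≠ e₀) : h e ∈ s ↔ t e ∈ s := hs ⟨e, he⟩
    have h0 : ¬ (h e₀ ∈ s ↔ t e₀ ∈ s) := by
      intro h0
      rcases hc s (fun e => if he : e = e₀ then he ▸ h0 else hs' e he) with h | h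
      · exact hs1.ne_empty h
      · exact hs2 h
    by_cases hh : h e₀ ∈ s
    · exact ⟨s.toFinset, by simpa using hs', by simpa using hh, by
        simpa using fun ht => h0 (by simp [hh, ht])⟩
    · exact ⟨sᶜ.toFinset, by simpa [not_iff_not] using hs', by simpa using hh, by
        simpa using by_contra fun ht => h0 (by simp [hh, ht])⟩
  obtain ⟨s, hs, hh, ht⟩ := hex
  refine ⟨s, hs, hh, ht, ?_⟩
  -- Both sides are connected, so each has at least as many inner edges as vertices less one. The
  -- total is |V| - 2, so both bounds are equalities, and `e₀` itself adds the missing edge on the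
  -- side of `s`.
  have hc1 := (hc.restrict (s := (s : Set V)) (e₀ := e₀) (by simpa using hs)
    (by simp [hh, ht])).card_le
  have hc2 := (hc.restrict (s := ((sᶜ : Finset V) : Set V)) (e₀ := e₀)
    (by simpa [not_iff_not] using hs) (by simp [hh, ht])).card_le
  have e1 : Fintype.card {e // e ≠ e₀ ∧ h e ∈ (s : Set V)} + 1
      = (Finset.univ.filter fun e => h e ∈ s).card := by
    rw [Fintype.card_subtype, ← Finset.card_erase_add_one (s := Finset.univ.filter fun e => h e ∈ s)
      (a := e₀) (by simp [hh])]
    congr 2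
    ext e
    simp
  have e2 : Fintype.card {e // e ≠ e₀ ∧ h e ∈ ((sᶜ : Finset V) : Set V)}
      = (Finset.univ.filter fun e => ¬ h e ∈ s).card := by
    rw [Fintype.card_subtype]
    congr 1
    ext e
    simp only [Finset.mem_filter, Finset.mem_univ, true_and, Finset.coe_compl, Set.mem_compl_iff,
      Finset.mem_coe, and_iff_right_iff_imp]
    rintro he rfl
    exact he hh
  have e3 := Finset.card_filter_add_card_filter_not (s := Finset.univ) (fun e => h e ∈ s)
  have c1 : Fintype.card (s : Set V) = s.card := by simp
  have c2 : Fintype.card ((sᶜ : Finset V) : Set V) = Fintype.card V - s.card := by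
    simp only [Finset.coe_sort_coe, Fintype.card_coe, Finset.card_compl]
  have := s.card_le_univ
  rw [Finset.card_univ] at e3
  omega

/-! ### Faces, vertices and edges of polyhedra in standard form. -/

section StandardPolytope

variable {ι V : Type*} [AddCommGroup V] [Module ℝ V]

/-- The polyhedron `{x ≥ 0 | L x = b}`. -/
def standardPolytope (L : (ι → ℝ) →ₗ[ℝ] V) (b : V) : Set (ι → ℝ) :=
  {x | (∀ e, 0 ≤ x e) ∧ L x = b}

/-- The points of the polyhedron `{x ≥ 0 | L x = b}` whose coordinates in `Z` vanish. -/
def zeroFace (L : (ι → ℝ) →ₗ[ℝ] V) (b : V) (Z : Set ι) : Set (ι → ℝ) :=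
  {x | x ∈ standardPolytope L b ∧ ∀ e ∈ Z, x e = 0}

/-- The vectors in the kernel of `L` whose coordinates in `Z` vanish. -/
def kerVanishing (L : (ι → ℝ) →ₗ[ℝ] V) (Z : Set ι) : Submodule ℝ (ι → ℝ) where
  carrier := {w | L w = 0 ∧ ∀ e ∈ Z, w e = 0}
  add_mem' := by
    rintro a b ⟨ha, ha'⟩ ⟨hb, hb'⟩
    exact ⟨by simp [ha, hb], fun e he => by simp [ha' e he, hb' e he]⟩
  zero_mem' := by simp
  smul_mem' := by
    rintro c a ⟨ha, ha'⟩
    exact ⟨by simp [ha], fun e he => by simp [ha' e he]⟩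

variable {L : (ι → ℝ) →ₗ[ℝ] V} {b : V}

theorem mem_kerVanishing {Z : Set ι} {w : ι → ℝ} :
    w ∈ kerVanishing L Z ↔ L w = 0 ∧ ∀ e ∈ Z, w e = 0 := Iff.rfl

theorem convex_standardPolytope : Convex ℝ (standardPolytope L b) := by
  rintro x ⟨hx, hx'⟩ y ⟨hy, hy'⟩ s t hs ht hst
  refine ⟨fun e => ?_, ?_⟩
  · have := mul_nonneg hs (hx e)
    have := mul_nonneg ht (hy e)
    simpa using by linarith
  · simp [hx', hy', ← add_smul, hst]

theorem sub_mem_kerVanishing {Z : Set ι} {x y : ι → ℝ} (hx : x ∈ zeroFace L b Z)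
    (hy : y ∈ zeroFace L b Z) : x - y ∈ kerVanishing L Z :=
  ⟨by simp [hx.1.2, hy.1.2], fun e he => by simp [hx.2 e he, hy.2 e he]⟩

theorem mem_zeroFace_zeros {x : ι → ℝ} (hx : x ∈ standardPolytope L b) :
    x ∈ zeroFace L b {e | x e = 0} := ⟨hx, fun _ he => he⟩

/-- A compact convex set on which some coordinate is injective is a segment. -/
theorem exists_extremePoints_eq_pair {F : Set (ι → ℝ)} (hF : Convex ℝ F) (hc : IsCompact F)
    (hs : ¬ F.Subsingleton) {e : ι} (he : Set.InjOn (fun x : ι → ℝ => x e) F) :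
    ∃ p q, p ≠ q ∧ F.extremePoints ℝ = {p, q} := by
  have hne : F.Nonempty := by
    rw [Set.nonempty_iff_ne_empty]
    rintro rfl
    exact hs Set.subsingleton_empty
  have hcont : ContinuousOn (fun x : ι → ℝ => x e) F := (continuous_apply e).continuousOn
  obtain ⟨p, hp, hpmin⟩ := hc.exists_isMinOn hne hcont
  obtain ⟨q, hq, hqmax⟩ := hc.exists_isMaxOn hne hcont
  have hpmin' (x) (hx : x ∈ F) : p e ≤ x e := hpmin hx
  have hqmax' (x) (hx : x ∈ F) : x e ≤ q e := hqmax hx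
  refine ⟨p, q, ?_, ?_⟩
  · rintro rfl
    exact hs fun x hx y hy => he hx hy
      ((le_antisymm (hqmax' x hx) (hpmin' x hx)).trans
        (le_antisymm (hpmin' y hy) (hqmax' y hy)))
  · ext x
    rw [mem_extremePoints_iff_left]
    constructor
    · rintro ⟨hx, h⟩
      by_contra hpq
      simp only [Set.mem_insert_iff, Set.mem_singleton_iff, not_or] at hpq
      have h1 : p e < x e := lt_of_le_of_ne (hpmin' x hx) fun h => hpq.1 (he hp hx h).symm
      have h2 : x e < q e := lt_of_le_of_ne (hqmax' x hx) fun h => hpq.2 (he hx hq h)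
      have h3 : x e ∈ openSegment ℝ (p e) (q e) := by
        rw [openSegment_eq_Ioo (h1.trans h2)]
        exact ⟨h1, h2⟩
      obtain ⟨s, t, hs, ht, hst, h4⟩ := h3
      have h5 : s • p + t • q = x := he (hF hp hq hs.le ht.le hst) hx (by simpa using h4)
      exact hpq.1 (h p hp q hq ⟨s, t, hs, ht, hst, h5⟩).symm
    · have aux {s t u v w : ℝ} (hs : 0 < s) (ht : 0 < t) (hst : s + t = 1)
          (hw : s * u + t * v = w) (h : (w ≤ u ∧ w ≤ v) ∨ (u ≤ w ∧ v ≤ w)) : u = w := by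
        obtain rfl : s = 1 - t := by linarith
        subst hw
        rcases h with ⟨h1, h2⟩ | ⟨h1, h2⟩
        · nlinarith
        · nlinarith
      rintro (rfl | rfl)
      · refine ⟨hp, fun x₁ hx₁ x₂ hx₂ ⟨s, t, hs, ht, hst, h4⟩ => he hx₁ hp ?_⟩
        exact aux hs ht hst (by simpa using congrFun h4 e)
          (Or.inl ⟨hpmin' x₁ hx₁, hpmin' x₂ hx₂⟩)
      · refine ⟨hq, fun x₁ hx₁ x₂ hx₂ ⟨s, t, hs, ht, hst, h4⟩ => he hx₁ hq ?_⟩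
        exact aux hs ht hst (by simpa using congrFun h4 e)
          (Or.inr ⟨hqmax' x₁ hx₁, hqmax' x₂ hx₂⟩)

variable [Fintype ι]

theorem exists_forall_pos_add_mul (x w : ι → ℝ) :
    ∃ ε : ℝ, 0 < ε ∧ ∀ t : ℝ, |t| ≤ ε → ∀ e, 0 < x e → 0 < x e + t * w e := by
  have h1 : ∀ᶠ t in nhds (0 : ℝ), ∀ e, 0 < x e → 0 < x e + t * w e := by
    simp only [Filter.eventually_all]
    intro e he
    have hc : Continuous fun t : ℝ => x e + t * w e := by fun_prop
    exact hc.continuousAt.eventually (lt_mem_nhds (by simpa using he))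
  obtain ⟨ε, hε, h⟩ := Metric.eventually_nhds_iff.1 h1
  refine ⟨ε / 2, by positivity, fun t ht => h ?_⟩
  rw [Real.dist_eq, sub_zero]
  linarith

/-- One can move a little from a point of the polyhedron in any direction of `kerVanishing`. -/
theorem exists_add_smul_mem_zeroFace {Z : Set ι} {x w : ι → ℝ} (hx : x ∈ zeroFace L b Z)
    (hpos : ∀ e, e ∉ Z → x e ≠ 0) (hw : w ∈ kerVanishing L Z) :
    ∃ ε : ℝ, 0 < ε ∧ ∀ t : ℝ, |t| ≤ ε → x + t • w ∈ zeroFace L b Z := by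
  obtain ⟨ε, hε, h⟩ := exists_forall_pos_add_mul x w
  refine ⟨ε, hε, fun t ht => ?_⟩
  refine ⟨⟨fun e => ?_, by simp [hx.1.2, hw.1]⟩, fun e he => by simp [hx.2 e he, hw.2 e he]⟩
  by_cases he : e ∈ Z
  · simp [hx.2 e he, hw.2 e he]
  · simpa using (h t ht e (lt_of_le_of_ne (hx.1.1 e) (hpos e he).symm)).le

theorem isExposed_zeroFace (Z : Set ι) : IsExposed ℝ (standardPolytope L b) (zeroFace L b Z) := by
  classical
  rintro ⟨x₀, hx₀⟩
  refine ⟨-∑ e ∈ Z.toFinset, ContinuousLinearMap.proj e, ?_⟩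
  have hl (x : ι → ℝ) : (-∑ e ∈ Z.toFinset, ContinuousLinearMap.proj e :
      (ι → ℝ) →L[ℝ] ℝ) x = -∑ e ∈ Z.toFinset, x e := by simp
  ext x
  simp only [hl, Set.mem_ofPred_eq, neg_le_neg_iff]
  constructor
  · rintro ⟨hx, hx'⟩
    refine ⟨hx, fun y hy => ?_⟩
    rw [Finset.sum_eq_zero fun e he => hx' e (by simpa using he)]
    exact Finset.sum_nonneg fun e _ => hy.1 e
  · rintro ⟨hx, hx'⟩
    refine ⟨hx, fun e he => ?_⟩
    have h0 := hx' x₀ hx₀.1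
    rw [Finset.sum_eq_zero fun e he => hx₀.2 e (by simpa using he)] at h0
    have h1 := (Finset.sum_eq_zero_iff_of_nonneg fun e _ => hx.1 e).1
      (le_antisymm h0 (Finset.sum_nonneg fun e _ => hx.1 e))
    exact h1 e (by simpa using he)

/-- Every exposed face is cut out by the coordinates `Z` that vanish on it. Averaging points of `F`
gives `y` with no further zeros, a relative interior point. -/
theorem exists_eq_zeroFace {F : Set (ι → ℝ)} (hne : F.Nonempty)
    (hF : IsExposed ℝ (standardPolytope L b) F) :
    ∃ Z, F = zeroFace L b Z ∧ ∃ y ∈ F, ∀ e, e ∉ Z → y e ≠ 0 := by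
  classical
  have hconv : Convex ℝ F := hF.convex convex_standardPolytope
  set Z : Set ι := {e | ∀ x ∈ F, x e = 0} with hZ
  have hy : ∀ s : Finset ι, ∃ y ∈ F, ∀ e ∈ s, e ∉ Z → y e ≠ 0 := by
    intro s
    induction s using Finset.induction_on with
    | empty => exact ⟨hne.some, hne.some_mem, by simp⟩
    | insert e s _ ih =>
      obtain ⟨y, hyF, hy⟩ := ih
      by_cases he : e ∈ Z
      · refine ⟨y, hyF, fun e' he' he'' => hy e' ?_ he''⟩
        exact Finset.mem_of_mem_insert_of_ne he' fun h => he'' (h ▸ he)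
      · obtain ⟨x, hxF, hx⟩ : ∃ x ∈ F, x e ≠ 0 := by simpa [hZ] using he
        refine ⟨(1 / 2 : ℝ) • y + (1 / 2 : ℝ) • x,
          hconv hyF hxF (by norm_num) (by norm_num) (by norm_num), fun e' he' he'' => ?_⟩
        have h1 := (hF.subset hyF).1 e'
        have h2 := (hF.subset hxF).1 e'
        simp only [Pi.add_apply, Pi.smul_apply, smul_eq_mul]
        rcases Finset.mem_insert.1 he' with rfl | h3
        · have := lt_of_le_of_ne h2 hx.symm
          linarith
        · have := lt_of_le_of_ne h1 (hy e' h3 he'').symm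
          linarith
  obtain ⟨y, hyF, hy⟩ := hy Finset.univ
  refine ⟨Z, ?_, y, hyF, fun e => hy e (Finset.mem_univ e)⟩
  refine subset_antisymm (fun x hx => ⟨hF.subset hx, fun e he => he x hx⟩) fun z hz => ?_
  have hyZ : y ∈ zeroFace L b Z := ⟨hF.subset hyF, fun e he => he y hyF⟩
  obtain ⟨l, hl⟩ := hF hne
  -- From `y` one can step a little away from `z` inside the polyhedron. As `l` is maximal at `y`,
  -- it does not increase along this step, so `l z` is at least `l y`.
  obtain ⟨ε, hε, h⟩ := exists_add_smul_mem_zeroFace hyZ (fun e => hy e (Finset.mem_univ e))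
    (sub_mem_kerVanishing hyZ hz)
  have hmax := hyF
  rw [hl] at hmax ⊢
  have h1 := hmax.2 _ (h ε (abs_of_pos hε).le).1
  simp only [map_add, map_smul, map_sub, smul_eq_mul] at h1
  have h2 : l y ≤ l z := by nlinarith
  exact ⟨hz.1, fun x hx => (hmax.2 x hx).trans h2⟩

theorem vectorSpan_zeroFace {Z : Set ι} {y : ι → ℝ} (hy : y ∈ zeroFace L b Z)
    (hpos : ∀ e, e ∉ Z → y e ≠ 0) : vectorSpan ℝ (zeroFace L b Z) = kerVanishing L Z := by
  refine le_antisymm ?_ fun w hw => ?_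
  · rw [vectorSpan_def, Submodule.span_le]
    rintro _ ⟨x, hx, z, hz, rfl⟩
    exact sub_mem_kerVanishing hx hz
  · obtain ⟨ε, hε, h⟩ := exists_add_smul_mem_zeroFace hy hpos hw
    have := vsub_mem_vectorSpan ℝ (h ε (abs_of_pos hε).le) hy
    simp only [vsub_eq_sub, add_sub_cancel_left] at this
    exact (Submodule.smul_mem_iff _ hε.ne').1 this

/-- A kernel vector vanishing where `x` does can be added and subtracted in small multiples.
Conversely, where `x` vanishes, so do the ends of any segment in the polyhedron with `x` in its
interior. -/
theorem mem_extremePoints_standardPolytope_iff {x : ι → ℝ} :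
    x ∈ (standardPolytope L b).extremePoints ℝ ↔
      x ∈ standardPolytope L b ∧ kerVanishing L {e | x e = 0} = ⊥ := by
  rw [mem_extremePoints_iff_left]
  refine and_congr_right fun hx => ⟨fun h => ?_, fun h x₁ hx₁ x₂ hx₂ hseg => ?_⟩
  · rw [Submodule.eq_bot_iff]
    intro w hw
    obtain ⟨ε, hε, h'⟩ := exists_add_smul_mem_zeroFace (mem_zeroFace_zeros hx) (fun e he => he) hw
    have := h _ (h' ε (abs_of_pos hε).le).1 _ (h' (-ε) (by simp [abs_of_pos hε])).1
      ⟨1 / 2, 1 / 2, by norm_num, by norm_num, by norm_num, by ext; simp; ring⟩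
    simpa [hε.ne'] using this
  · obtain ⟨s, t, hs, ht, _, rfl⟩ := hseg
    have : x₁ - (s • x₁ + t • x₂) ∈ kerVanishing L {e | (s • x₁ + t • x₂) e = 0} := by
      refine ⟨by rw [map_sub, hx₁.2, hx.2, sub_self], fun e he => ?_⟩
      have h1 := hx₁.1 e
      have h2 := mul_nonneg ht.le (hx₂.1 e)
      have he' : (s • x₁ + t • x₂) e = 0 := he
      have h3 : s * x₁ e + t * x₂ e = 0 := by simpa using he'
      have h4 : x₁ e ≤ 0 := by
        by_contra! h5
        have := mul_pos hs h5
        linarith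
      simp only [Pi.sub_apply, he']
      linarith
    rw [h, Submodule.mem_bot, sub_eq_zero] at this
    exact this

theorem zeroFace_zeros_eq_singleton {x : ι → ℝ}
    (hx : x ∈ (standardPolytope L b).extremePoints ℝ) :
    zeroFace L b {e | x e = 0} = {x} := by
  obtain ⟨hx, hk⟩ := mem_extremePoints_standardPolytope_iff.1 hx
  refine subset_antisymm (fun z hz => ?_) (by simpa using mem_zeroFace_zeros hx)
  have := sub_mem_kerVanishing hz (mem_zeroFace_zeros hx)
  rwa [hk, Submodule.mem_bot, sub_eq_zero] at this

theorem facesOfDim_zero_standardPolytope :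
    facesOfDim (standardPolytope L b) 0 =
      (fun x => {x}) '' (standardPolytope L b).extremePoints ℝ := by
  ext F
  constructor
  · rintro ⟨⟨x, hx⟩, hF, h0⟩
    have hs : F.Subsingleton := by
      rw [← vectorSpan_eq_bot_iff_subsingleton (k := ℝ)]
      exact Submodule.finrank_eq_zero.1 h0
    obtain rfl := hs.eq_singleton_of_mem hx
    exact ⟨x, isExtreme_singleton.1 hF.isExtreme, rfl⟩
  · rintro ⟨x, hx, rfl⟩
    refine ⟨Set.singleton_nonempty x, ?_, by simp⟩
    change IsExposed ℝ _ ({x} : Set (ι → ℝ))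
    rw [← zeroFace_zeros_eq_singleton hx]
    exact isExposed_zeroFace _

theorem finite_facesOfDim_standardPolytope (k : ℕ) :
    (facesOfDim (standardPolytope L b) k).Finite := by
  refine (Set.finite_range (zeroFace L b)).subset ?_
  rintro F ⟨hne, hF, _⟩
  obtain ⟨Z, rfl, _⟩ := exists_eq_zeroFace hne hF
  exact ⟨Z, rfl⟩

theorem ncard_facesOfDim_zero_standardPolytope :
    (facesOfDim (standardPolytope L b) 0).ncard =
      ((standardPolytope L b).extremePoints ℝ).ncard := by
  rw [facesOfDim_zero_standardPolytope, Set.ncard_image_of_injective _ Set.singleton_injective]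

theorem finite_extremePoints_standardPolytope :
    ((standardPolytope L b).extremePoints ℝ).Finite := by
  have := finite_facesOfDim_standardPolytope (L := L) (b := b) 0
  rw [facesOfDim_zero_standardPolytope] at this
  exact this.of_finite_image Set.singleton_injective.injOn

theorem ncard_extremePoints_mem_edge (hc : IsCompact (standardPolytope L b)) {F : Set (ι → ℝ)}
    (hF : F ∈ facesOfDim (standardPolytope L b) 1) :
    {x | x ∈ (standardPolytope L b).extremePoints ℝ ∧ x ∈ F}.ncard = 2 := by
  obtain ⟨hne, hF, h1⟩ := hF
  have hs : ¬ F.Subsingleton := by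
    intro h
    rw [vectorSpan_of_subsingleton ℝ h, finrank_bot] at h1
    exact zero_ne_one h1
  obtain ⟨v, hv0, hv⟩ := finrank_eq_one_iff'.1 h1
  obtain ⟨e, he⟩ : ∃ e, v.1 e ≠ 0 := by
    by_contra! h
    exact hv0 (Subtype.ext (funext h))
  obtain ⟨p, q, hpq, hext⟩ := exists_extremePoints_eq_pair (hF.convex convex_standardPolytope)
    (hF.isCompact hc) hs (e := e) fun x hx y hy hxy => by
      obtain ⟨c, hcv⟩ := hv ⟨x - y, vsub_mem_vectorSpan ℝ hx hy⟩
      have hcv' : c • v.1 = x - y := congrArg Subtype.val hcv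
      have h2 := congrFun hcv' e
      have hxy' : x e = y e := hxy
      simp only [Pi.smul_apply, smul_eq_mul, Pi.sub_apply, hxy', sub_self, mul_eq_zero, he,
        or_false] at h2
      rw [h2, zero_smul] at hcv'
      exact (sub_eq_zero.1 hcv'.symm)
  have : {x | x ∈ (standardPolytope L b).extremePoints ℝ ∧ x ∈ F} = {p, q} := by
    rw [← hext, hF.isExtreme.extremePoints_eq]
    ext x
    exact and_comm
  rw [this, Set.ncard_pair hpq]

/-- Restriction to the zero coordinates of `x` is injective on the kernel at a vertex, hence
bijective by `hD`. The dual basis `w` gives the directions of the edges at `x`: each edge arises by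
releasing exactly one zero coordinate. -/
theorem ncard_edges_mem_extremePoint {x : ι → ℝ}
    (hx : x ∈ (standardPolytope L b).extremePoints ℝ)
    (hD : Nat.card {e // x e = 0} = Module.finrank ℝ (LinearMap.ker L)) :
    {F | F ∈ facesOfDim (standardPolytope L b) 1 ∧ x ∈ F}.ncard =
      Module.finrank ℝ (LinearMap.ker L) := by
  classical
  obtain ⟨hxP, hk⟩ := mem_extremePoints_standardPolytope_iff.1 hx
  have hxF := mem_zeroFace_zeros hxP
  let Φ : LinearMap.ker L →ₗ[ℝ] ({e // x e = 0} → ℝ) :=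
    (LinearMap.funLeft ℝ ℝ Subtype.val).comp (LinearMap.ker L).subtype
  have hΦi : Function.Injective Φ := by
    rw [← LinearMap.ker_eq_bot, LinearMap.ker_eq_bot']
    intro w hw
    have : w.1 ∈ kerVanishing L {e | x e = 0} := ⟨w.2, fun e he => congrFun hw ⟨e, he⟩⟩
    rw [hk, Submodule.mem_bot] at this
    exact Subtype.ext this
  have hΦs : Function.Surjective Φ :=
    (LinearMap.injective_iff_surjective_of_finrank_eq_finrank (by
      rw [Module.finrank_fintype_fun_eq_card, ← Nat.card_eq_fintype_card, hD])).1 hΦi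
  have hw : ∀ e : {e // x e = 0}, ∃ w, L w = 0 ∧ w e = 1 ∧ ∀ e', x e' = 0 → e' ≠ e → w e' = 0 := by
    intro e
    obtain ⟨w, hw⟩ := hΦs (Pi.single e 1)
    have hw' (e' : {e // x e = 0}) : w.1 e' = (Pi.single e 1 : {e // x e = 0} → ℝ) e' :=
      congrFun hw e'
    refine ⟨w, w.2, by simpa using hw' e, fun e' he' hne => ?_⟩
    rw [hw' ⟨e', he'⟩, Pi.single_eq_of_ne]
    exact fun h => hne (congrArg Subtype.val h)
  choose w hwL hw1 hw0 using hw
  let Z (e : {e // x e = 0}) : Set ι := {e' | x e' = 0 ∧ e' ≠ e}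
  have hwZ (e) : w e ∈ kerVanishing L (Z e) := ⟨hwL e, fun e' he' => hw0 e e' he'.1 he'.2⟩
  have hkZ (e) : kerVanishing L (Z e) = Submodule.span ℝ {w e} := by
    refine le_antisymm (fun u hu => ?_) (by simpa using hwZ e)
    have : u - u e • w e ∈ kerVanishing L {e | x e = 0} := by
      refine ⟨by simp [hu.1, hwL], fun e' he' => ?_⟩
      rcases eq_or_ne e' e with rfl | hne
      · simp [hw1]
      · simp [hu.2 e' ⟨he', hne⟩, hw0 e e' he' hne]
    rw [hk, Submodule.mem_bot, sub_eq_zero] at this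
    exact Submodule.mem_span_singleton.2 ⟨_, this.symm⟩
  have hpt (e : {e // x e = 0}) : ∃ y ∈ zeroFace L b (Z e), ∀ e', e' ∉ Z e → y e' ≠ 0 := by
    obtain ⟨ε, hε, h⟩ := exists_forall_pos_add_mul x (w e)
    have h0 (e') (he' : e' ∉ Z e) : 0 < x e' + ε * w e e' := by
      by_cases hx0 : x e' = 0
      · obtain rfl : e' = e := by by_contra hne; exact he' ⟨hx0, hne⟩
        simpa [hx0, hw1] using hε
      · exact h ε (abs_of_pos hε).le e' (lt_of_le_of_ne (hxP.1 e') (Ne.symm hx0))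
    refine ⟨x + ε • w e, ⟨⟨fun e' => ?_, by simp [hxP.2, hwL]⟩, fun e' he' => ?_⟩,
      fun e' he' => by simpa using (h0 e' he').ne'⟩
    · by_cases he' : e' ∈ Z e
      · simp [he'.1, hw0 e e' he'.1 he'.2]
      · simpa using (h0 e' he').le
    · simp [he'.1, hw0 e e' he'.1 he'.2]
  have hwne (e) : w e ≠ 0 := fun h => by simpa [h] using hw1 e
  have hinj : Function.Injective fun e => zeroFace L b (Z e) := by
    intro e₁ e₂ h
    by_contra hne
    obtain ⟨y, hy, hy0⟩ := hpt e₁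
    refine hy0 e₁ (fun h => h.2 rfl) ?_
    have hy' : y ∈ zeroFace L b (Z e₂) := (show zeroFace L b (Z e₁) = zeroFace L b (Z e₂) from h) ▸ hy
    exact hy'.2 e₁ ⟨e₁.2, fun h => hne (Subtype.ext h)⟩
  have hrange : {F | F ∈ facesOfDim (standardPolytope L b) 1 ∧ x ∈ F} =
      Set.range fun e => zeroFace L b (Z e) := by
    ext F
    constructor
    · rintro ⟨⟨hne, hF, h1⟩, hxF'⟩
      obtain ⟨Z', rfl, y, hy, hy0⟩ := exists_eq_zeroFace hne hF
      rw [vectorSpan_zeroFace hy hy0] at h1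
      have hsub (e') (he' : e' ∈ Z') : x e' = 0 := hxF'.2 e' he'
      obtain ⟨e, he, heZ⟩ : ∃ e, x e = 0 ∧ e ∉ Z' := by
        by_contra! hall
        have : Z' = {e | x e = 0} := subset_antisymm hsub hall
        rw [this, hk, finrank_bot] at h1
        exact zero_ne_one h1
      obtain ⟨v, _, hv⟩ := finrank_eq_one_iff'.1 h1
      have hmem (e) (he : e.1 ∉ Z') : w e ∈ kerVanishing L Z' :=
        ⟨hwL e, fun e' he' => hw0 e e' (hsub e' he') fun h => he ((show e' = e.1 from h) ▸ he')⟩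
      refine ⟨⟨e, he⟩, congrArg (zeroFace L b) (subset_antisymm ?_ ?_)⟩
      -- Two released coordinates would give two independent vectors `w` in a one-dimensional space.
      · rintro e' ⟨he', hne'⟩
        by_contra heZ'
        obtain ⟨c, hc⟩ := hv ⟨w ⟨e, he⟩, hmem ⟨e, he⟩ heZ⟩
        obtain ⟨c', hc'⟩ := hv ⟨w ⟨e', he'⟩, hmem ⟨e', he'⟩ heZ'⟩
        have hc1 : c • v.1 = w ⟨e, he⟩ := congrArg Subtype.val hc
        have hc1' : c' • v.1 = w ⟨e', he'⟩ := congrArg Subtype.val hc'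
        have k1 := congrFun hc1 e
        have k2 := congrFun hc1' e
        have k3 := congrFun hc1' e'
        rw [hw1 ⟨e, he⟩] at k1
        rw [hw0 ⟨e', he'⟩ e he hne'.symm] at k2
        rw [hw1 ⟨e', he'⟩] at k3
        simp only [Pi.smul_apply, smul_eq_mul] at k1 k2 k3
        rcases mul_eq_zero.1 k2 with h | h
        · simp [h] at k3
        · simp [h] at k1
      · exact fun e' he' => ⟨hsub e' he', fun h => heZ ((show e' = e from h) ▸ he')⟩
    · rintro ⟨e, rfl⟩
      obtain ⟨y, hy, hy0⟩ := hpt e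
      refine ⟨⟨⟨y, hy⟩, isExposed_zeroFace _, ?_⟩, hxP, fun e' he' => he'.1⟩
      rw [vectorSpan_zeroFace hy hy0, hkZ, finrank_span_singleton (hwne e)]
  rw [hrange, ← Set.image_univ, Set.ncard_image_of_injective _ hinj, Set.ncard_univ, hD]

/-- Edges and vertices of a simple polytope: every vertex lies on as many edges as the dimension of
the polytope, every edge has two vertices. -/
theorem two_mul_ncard_edges (hc : IsCompact (standardPolytope L b))
    (hD : ∀ x ∈ (standardPolytope L b).extremePoints ℝ,
      Nat.card {e // x e = 0} = Module.finrank ℝ (LinearMap.ker L)) :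
    ((standardPolytope L b).extremePoints ℝ).ncard * Module.finrank ℝ (LinearMap.ker L) =
      (facesOfDim (standardPolytope L b) 1).ncard * 2 := by
  classical
  have hV := finite_extremePoints_standardPolytope (L := L) (b := b)
  have hE := finite_facesOfDim_standardPolytope (L := L) (b := b) 1
  rw [Set.ncard_eq_toFinset_card _ hV, Set.ncard_eq_toFinset_card _ hE]
  refine Finset.card_mul_eq_card_mul (fun x F => x ∈ F) (fun x hx => ?_) (fun F hF => ?_)
  · rw [Set.Finite.mem_toFinset] at hx
    rw [← ncard_edges_mem_extremePoint hx (hD x hx), ← Set.ncard_coe_finset]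
    congr 1
    ext F
    simp [Finset.bipartiteAbove]
  · rw [Set.Finite.mem_toFinset] at hF
    rw [← ncard_extremePoints_mem_edge hc hF, ← Set.ncard_coe_finset]
    congr 1
    ext F
    simp [Finset.bipartiteBelow]

end StandardPolytope

/-! ### Cauchy–Binet, incidence determinants and the weighted Laplacian. -/

/-- The Cauchy–Binet formula, summed over all maps from the rows to the columns. -/
theorem Matrix.card_factorial_mul_det_mul_transpose {r E R : Type*} [Fintype r] [DecidableEq r]
    [Fintype E] [CommRing R] (A B : Matrix r E R) :
    ((Fintype.card r).factorial : R) * (A * B.transpose).det =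
      ∑ f : r → E, (A.submatrix id f).det * (B.submatrix id f).det := by
  classical
  have h1 : (A * B.transpose).det = ∑ f : r → E, (A.submatrix id f).det * ∏ i, B i (f i) := by
    simp only [Matrix.det_apply, Matrix.mul_apply, Matrix.transpose_apply,
      Finset.prod_univ_sum, Fintype.piFinset_univ, Finset.smul_sum, Finset.sum_mul]
    rw [Finset.sum_comm]
    refine Finset.sum_congr rfl fun f _ => Finset.sum_congr rfl fun σ _ => ?_
    simp [Finset.prod_mul_distrib, smul_mul_assoc]
  -- Reindexing `f` by `τ` permutes the columns of the first minor, and the two signs cancel. Each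
  -- permutation in the expansion of the second minor thus contributes one copy of the determinant.
  have h2 (τ : Equiv.Perm r) :
      ∑ f : r → E, (A.submatrix id f).det * (Equiv.Perm.sign τ • ∏ i, B (τ i) (f i)) =
        (A * B.transpose).det := by
    rw [h1, ← (Equiv.arrowCongr τ.symm (Equiv.refl E)).sum_comp]
    refine Finset.sum_congr rfl fun f _ => ?_
    have h3 : A.submatrix id (Equiv.arrowCongr τ.symm (Equiv.refl E) f) =
        (A.submatrix id f).submatrix id τ := by
      ext; simp
    rw [h3, Matrix.det_permute', ← (Equiv.prod_comp τ fun i => B i _)]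
    rcases Int.units_eq_one_or (Equiv.Perm.sign τ) with h | h <;> simp [h]
  conv_rhs => enter [2, f]; rw [Matrix.det_apply (B.submatrix id f), Finset.mul_sum]
  rw [Finset.sum_comm]
  simp only [Matrix.submatrix_apply, id_eq, h2]
  simp [Fintype.card_perm]

open Classical in
/-- The square incidence matrix of a multigraph with one vertex deleted has determinant `±1` when
the multigraph is connected and `0` otherwise. -/
theorem sq_det_incidence {V r : Type*} [Fintype r] [DecidableEq r] [DecidableEq V] {i : r → V} (hi : Function.Injective i)
    {v₀ : V} (hi0 : ∀ a, i a ≠ v₀) (hiv : ∀ v, v ≠ v₀ → ∃ a, i a = v) (h t : r → V) :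
    (Matrix.of fun a e => (if h e = i a then (1 : ℤ) else 0) - if t e = i a then 1 else 0).det ^ 2 =
      if EdgeConnected h t then 1 else 0 := by
  set B : Matrix r r ℤ :=
    Matrix.of fun a e => (if h e = i a then (1 : ℤ) else 0) - if t e = i a then 1 else 0 with hB
  split_ifs with hc
  · let δ (v : V) : r → ℤ := fun a => if v = i a then 1 else 0
    -- The vertices whose `δ` is an integral combination of columns form a set that no edge leaves.
    -- It contains `v₀`, since `δ v₀ = 0`, so it is everything and `B` has an integral inverse.
    have hδ : ∀ v, ∃ c, B.mulVec c = δ v := by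
      have hs (e : r) : h e ∈ {v | ∃ c, B.mulVec c = δ v} ↔ t e ∈ {v | ∃ c, B.mulVec c = δ v} := by
        have he : B.mulVec (Pi.single e 1) = δ (h e) - δ (t e) := by
          ext a
          simp [hB, δ]
        constructor
        · rintro ⟨c, hc⟩
          exact ⟨c - Pi.single e 1, by rw [Matrix.mulVec_sub, hc, he]; abel⟩
        · rintro ⟨c, hc⟩
          exact ⟨c + Pi.single e 1, by rw [Matrix.mulVec_add, hc, he]; abel⟩
      rcases hc _ hs with h0 | h0
      · have : v₀ ∈ {v | ∃ c, B.mulVec c = δ v} := by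
          refine ⟨0, ?_⟩
          ext a
          simp [δ, (hi0 a).symm]
        simp [h0] at this
      · exact fun v => (h0 ▸ Set.mem_univ v : v ∈ {v | ∃ c, B.mulVec c = δ v})
    choose c hcδ using hδ
    have hinv : B * Matrix.of (fun a b => c (i b) a) = 1 := by
      ext a b
      have := congrFun (hcδ (i b)) a
      simp only [Matrix.mulVec, dotProduct, δ] at this
      rw [Matrix.mul_apply]
      simp only [Matrix.of_apply, this, Matrix.one_apply, hi.eq_iff, eq_comm]
    have hu : IsUnit B.det := IsUnit.of_mul_eq_one _ (by rw [← Matrix.det_mul, hinv, Matrix.det_one])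
    rcases Int.isUnit_iff.1 hu with h | h <;> simp [h]
  · rw [sq_eq_zero_iff, ← Matrix.exists_vecMul_eq_zero_iff]
    simp only [EdgeConnected] at hc
    push Not at hc
    obtain ⟨s, hs, hs1, hs2⟩ := hc
    -- The indicator of the side of the separation not containing `v₀`: it vanishes at the deleted
    -- vertex and is constant along edges, so it is a left null vector.
    let φ (v : V) : ℤ := if (v ∈ s ↔ v₀ ∈ s) then 0 else 1
    refine ⟨fun a => φ (i a), ?_, ?_⟩
    · intro h0
      have hall (v : V) : v ∈ s ↔ v₀ ∈ s := by
        rcases eq_or_ne v v₀ with rfl | hv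
        · rfl
        · obtain ⟨a, rfl⟩ := hiv v hv
          simpa [φ] using congrFun h0 a
      by_cases hv : v₀ ∈ s
      · exact hs2 (Set.eq_univ_of_forall fun v => (hall v).2 hv)
      · exact hs1.ne_empty (Set.eq_empty_of_forall_notMem fun v => mt (hall v).1 hv)
    · have key (v : V) : ∑ a, φ (i a) * (if v = i a then 1 else 0) = φ v := by
        rcases eq_or_ne v v₀ with rfl | hv
        · simp [φ, fun a => (hi0 a).symm]
        · obtain ⟨a, rfl⟩ := hiv v hv
          simp [hi.eq_iff]
      ext e
      simp only [Matrix.vecMul, dotProduct, hB, Matrix.of_apply, mul_sub, Finset.sum_sub_distrib,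
        key, Pi.zero_apply]
      simp [φ, hs e]

/-- The incidence matrix of the complete bipartite graph on `M` and `N` without the row of `ν₀`. -/
def reducedIncidence (R M : Type*) [CommRing R] {N : Type*} [DecidableEq M] [DecidableEq N]
    (ν₀ : N) : Matrix (M ⊕ {ν : N // ν ≠ ν₀}) (M × N) R :=
  Matrix.of fun a e => Sum.elim (fun μ => if e.1 = μ then 1 else 0)
    (fun ν => if e.2 = ν.1 then -1 else 0) a

open Classical in
theorem sq_det_reducedIncidence_submatrix (R : Type*) {M N : Type*} [CommRing R] [Fintype M]
    [DecidableEq M] [Fintype N] [DecidableEq N] (ν₀ : N) (f : M ⊕ {ν : N // ν ≠ ν₀} → M × N) :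
    ((reducedIncidence R M ν₀).submatrix id f).det ^ 2 =
      if EdgeConnected (fun a => (Sum.inl (f a).1 : M ⊕ N)) (fun a => Sum.inr (f a).2)
        then 1 else 0 := by
  have h := sq_det_incidence (i := (Sum.map id Subtype.val : M ⊕ {ν : N // ν ≠ ν₀} → M ⊕ N))
    (Sum.map_injective.2 ⟨Function.injective_id, Subtype.val_injective⟩) (v₀ := Sum.inr ν₀)
    (by rintro (a | ⟨a, ha⟩) <;> simp_all)
    (by
      rintro (v | v) hv
      · exact ⟨Sum.inl v, rfl⟩
      · exact ⟨Sum.inr ⟨v, fun h => hv (h ▸ rfl)⟩, rfl⟩)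
    (fun a => (Sum.inl (f a).1 : M ⊕ N)) (fun a => Sum.inr (f a).2)
  have h' := congrArg (Int.castRingHom R) h
  rw [map_pow, RingHom.map_det] at h'
  convert h' using 2
  · congr! 1
    ext a e
    rcases a with a | a
    · simp [reducedIncidence]
    · by_cases ha : (f e).2 = a.1 <;> simp [reducedIncidence, ha]
  · split_ifs <;> simp

/-- The determinant of the reduced weighted Laplacian of the complete bipartite graph in which the
edge `(μ, ν)` has weight `X μ`. -/
theorem card_mul_det_reduced_laplacian {K M N : Type*} [Field K] [CharZero K] [Fintype M]
    [DecidableEq M] [Fintype N] [DecidableEq N] (ν₀ : N) (X : M → K) (hX : ∀ μ, X μ ≠ 0) :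
    (Fintype.card N : K) * (reducedIncidence K M ν₀ * Matrix.diagonal (fun e : M × N => X e.1) *
        (reducedIncidence K M ν₀).transpose).det =
      (Fintype.card N : K) ^ Fintype.card M * (∑ μ, X μ) ^ (Fintype.card N - 1) * ∏ μ, X μ := by
  have hn : (Fintype.card N : K) ≠ 0 := by
    have : Nonempty N := ⟨ν₀⟩
    exact_mod_cast Fintype.card_ne_zero
  set S := ∑ μ, X μ with hS
  have hblock : reducedIncidence K M ν₀ * Matrix.diagonal (fun e : M × N => X e.1) *
        (reducedIncidence K M ν₀).transpose =
      Matrix.fromBlocks (Matrix.diagonal fun μ => (Fintype.card N : K) * X μ)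
        (Matrix.of fun μ _ => - X μ) (Matrix.of fun _ μ => - X μ)
        (Matrix.diagonal fun _ => S) := by
    ext (a | a) (b | b)
    · simp [Matrix.mul_apply, Matrix.diagonal_apply, reducedIncidence, Fintype.sum_prod_type]
      by_cases hab : a = b
      · simp [hab]
      · simp [hab, Ne.symm hab]
    · simp [Matrix.mul_apply, Matrix.diagonal_apply, reducedIncidence, Fintype.sum_prod_type]
    · simp [Matrix.mul_apply, Matrix.diagonal_apply, reducedIncidence, Fintype.sum_prod_type]
    · simp [Matrix.mul_apply, Matrix.diagonal_apply, reducedIncidence, Fintype.sum_prod_type]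
      by_cases hab : a = b
      · simp [hab, hS]
      · simp [hab, Subtype.coe_inj, Ne.symm hab]
  have hU : IsUnit (Matrix.diagonal fun μ => (Fintype.card N : K) * X μ) := by
    rw [Matrix.isUnit_diagonal, Pi.isUnit_iff]
    exact fun μ => (mul_ne_zero hn (hX μ)).isUnit
  let _ := hU.invertible
  rw [hblock, Matrix.det_fromBlocks₁₁]
  have hinv : ⅟(Matrix.diagonal fun μ => (Fintype.card N : K) * X μ) =
      Matrix.diagonal fun μ => ((Fintype.card N : K) * X μ)⁻¹ := by
    refine invOf_eq_right_inv ?_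
    rw [Matrix.diagonal_mul_diagonal, ← Matrix.diagonal_one]
    congr 1
    ext μ
    exact mul_inv_cancel₀ (mul_ne_zero hn (hX μ))
  -- The Schur complement is S(1 - J/n) with J the all-ones matrix of size n - 1, so its determinant
  -- is S^(n-1)/n.
  have hschur : (Matrix.diagonal fun _ => S) - (Matrix.of fun (_ : {ν : N // ν ≠ ν₀}) μ => - X μ) *
        ⅟(Matrix.diagonal fun μ => (Fintype.card N : K) * X μ) * (Matrix.of fun μ _ => - X μ) =
      S • (1 + Matrix.replicateCol Unit (fun _ : {ν : N // ν ≠ ν₀} => -(Fintype.card N : K)⁻¹) *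
        Matrix.replicateRow Unit (fun _ : {ν : N // ν ≠ ν₀} => (1 : K))) := by
    rw [hinv]
    ext a b
    have (μ : M) : X μ * ((X μ)⁻¹ * (Fintype.card N : K)⁻¹) * X μ =
        X μ * (Fintype.card N : K)⁻¹ := by
      rw [← mul_assoc, mul_inv_cancel₀ (hX μ)]
      ring
    have hsum : ((Matrix.of fun (_ : {ν : N // ν ≠ ν₀}) μ => - X μ) *
        (Matrix.diagonal fun μ => ((Fintype.card N : K) * X μ)⁻¹) *
        (Matrix.of fun μ (_ : {ν : N // ν ≠ ν₀}) => - X μ)) a b = S * (Fintype.card N : K)⁻¹ := by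
      simp [Matrix.mul_apply, Matrix.diagonal_apply, this, ← Finset.sum_mul, hS]
    rw [Matrix.sub_apply, hsum]
    simp [Matrix.diagonal_apply, Matrix.mul_apply, Matrix.one_apply]
    split_ifs <;> ring
  rw [hschur, Matrix.det_smul, Matrix.det_one_add_replicateCol_mul_replicateRow, Matrix.det_diagonal,
    Finset.prod_mul_distrib]
  have hcard : Fintype.card {ν : N // ν ≠ ν₀} = Fintype.card N - 1 := by
    rw [Fintype.card_subtype_compl, Fintype.card_subtype_eq]
  have hpos : 1 ≤ Fintype.card N := Fintype.card_pos_iff.2 ⟨ν₀⟩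
  simp only [dotProduct, one_mul, Finset.prod_const, Finset.card_univ, hcard, Finset.sum_const,
    nsmul_eq_mul, Nat.cast_sub hpos, Nat.cast_one]
  field_simp
  ring

/-- The Schur complement inverts the weights, so the identity is proved in the fraction field and
pulled back to polynomials, where coefficients can be compared. -/
theorem natCast_mul_det_reduced_laplacian {M N : Type*} [Fintype M] [DecidableEq M] [Fintype N]
    [DecidableEq N] (ν₀ : N) :
    (Fintype.card N : MvPolynomial M ℚ) * (reducedIncidence (MvPolynomial M ℚ) M ν₀ *
      Matrix.diagonal (fun e : M × N => (MvPolynomial.X e.1 : MvPolynomial M ℚ)) *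
        (reducedIncidence (MvPolynomial M ℚ) M ν₀).transpose).det =
      (Fintype.card N : MvPolynomial M ℚ) ^ Fintype.card M *
        (∑ μ, MvPolynomial.X μ) ^ (Fintype.card N - 1) * ∏ μ, MvPolynomial.X μ := by
  let K := FractionRing (MvPolynomial M ℚ)
  have hinj : Function.Injective (algebraMap (MvPolynomial M ℚ) K) :=
    FaithfulSMul.algebraMap_injective _ _
  have : CharZero K := charZero_of_injective_algebraMap hinj
  apply hinj
  have h := card_mul_det_reduced_laplacian ν₀
    (fun μ : M => algebraMap (MvPolynomial M ℚ) K (MvPolynomial.X μ))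
    (fun μ => by simp)
  have hB : (algebraMap (MvPolynomial M ℚ) K).mapMatrix (reducedIncidence (MvPolynomial M ℚ) M ν₀ *
      Matrix.diagonal (fun e : M × N => (MvPolynomial.X e.1 : MvPolynomial M ℚ)) *
        (reducedIncidence (MvPolynomial M ℚ) M ν₀).transpose) = reducedIncidence K M ν₀ *
      Matrix.diagonal (fun e : M × N => algebraMap (MvPolynomial M ℚ) K (MvPolynomial.X e.1)) *
        (reducedIncidence K M ν₀).transpose := by
    have : (reducedIncidence (MvPolynomial M ℚ) M ν₀).map (algebraMap (MvPolynomial M ℚ) K) =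
        reducedIncidence K M ν₀ := by
      ext (a | a) e <;> simp only [reducedIncidence, Matrix.map_apply, Matrix.of_apply,
        Sum.elim_inl, Sum.elim_inr] <;> split_ifs <;> simp
    rw [RingHom.mapMatrix_apply, Matrix.map_mul, Matrix.map_mul, Matrix.transpose_map, this,
      Matrix.diagonal_map (map_zero _)]
  simp only [map_mul, map_pow, map_sum, map_prod, map_natCast, RingHom.map_det, hB]
  exact h

open Classical in
/-- The number of sequences of edges of the complete bipartite graph that form a connected graph
with given degrees on the side `M`. -/
theorem card_mul_card_connected_sequences {M N : Type*} [Fintype M] [Fintype N] (ν₀ : N)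
    (d : M → ℕ) (hd : Fintype.card N = 1 + ∑ μ, d μ) :
    Fintype.card N * (Finset.univ.filter fun f : M ⊕ {ν : N // ν ≠ ν₀} → M × N =>
      EdgeConnected (fun a => (Sum.inl (f a).1 : M ⊕ N)) (fun a => Sum.inr (f a).2) ∧
        ∀ μ, (Finset.univ.filter fun a => (f a).1 = μ).card = d μ + 1).card * ∏ μ, (d μ).factorial =
      (Fintype.card (M ⊕ {ν : N // ν ≠ ν₀})).factorial *
        (Fintype.card N ^ Fintype.card M * (Fintype.card N - 1).factorial) := by
  have hdet := Matrix.card_factorial_mul_det_mul_transpose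
    (reducedIncidence (MvPolynomial M ℚ) M ν₀ *
      Matrix.diagonal (fun e : M × N => (MvPolynomial.X e.1 : MvPolynomial M ℚ))) (reducedIncidence (MvPolynomial M ℚ) M ν₀)
  -- The weights factor out of the first minor, leaving a squared incidence minor, which is 0 or 1.
  -- The exponent of the monomial records the degrees on the side `M`.
  have hterm (f : M ⊕ {ν : N // ν ≠ ν₀} → M × N) :
      ((reducedIncidence (MvPolynomial M ℚ) M ν₀ *
        Matrix.diagonal (fun e : M × N => (MvPolynomial.X e.1 : MvPolynomial M ℚ))).submatrix id f).det *
        ((reducedIncidence (MvPolynomial M ℚ) M ν₀).submatrix id f).det =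
      if EdgeConnected (fun a => (Sum.inl (f a).1 : M ⊕ N)) (fun a => Sum.inr (f a).2) then
        MvPolynomial.monomial (∑ a, Finsupp.single (f a).1 1) 1 else 0 := by
    have h1 : (reducedIncidence (MvPolynomial M ℚ) M ν₀ *
        Matrix.diagonal (fun e : M × N => (MvPolynomial.X e.1 : MvPolynomial M ℚ))).submatrix id f =
        (reducedIncidence (MvPolynomial M ℚ) M ν₀).submatrix id f *
          Matrix.diagonal (fun a => MvPolynomial.X (f a).1) := by
      ext a b
      simp
    rw [h1, Matrix.det_mul, Matrix.det_diagonal, mul_right_comm, ← sq,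
      sq_det_reducedIncidence_submatrix, ite_mul, one_mul, zero_mul, MvPolynomial.monomial_sum_one]
    rfl
  simp only [hterm] at hdet
  have hpoly := natCast_mul_det_reduced_laplacian (M := M) ν₀
  let D : M →₀ ℕ := Finsupp.equivFunOnFinite.symm d
  have hones : (∏ μ : M, MvPolynomial.X μ : MvPolynomial M ℚ) =
      MvPolynomial.monomial (∑ μ, Finsupp.single μ 1) 1 := by
    rw [MvPolynomial.monomial_sum_one]
    rfl
  have hmain : (Fintype.card N : MvPolynomial M ℚ) *
      (∑ f : M ⊕ {ν : N // ν ≠ ν₀} → M × N,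
        if EdgeConnected (fun a => (Sum.inl (f a).1 : M ⊕ N)) (fun a => Sum.inr (f a).2) then
          MvPolynomial.monomial (∑ a, Finsupp.single (f a).1 1) 1 else 0) =
      ((Fintype.card (M ⊕ {ν : N // ν ≠ ν₀})).factorial : MvPolynomial M ℚ) *
        (((Fintype.card N ^ Fintype.card M : ℕ) : MvPolynomial M ℚ) *
          ((∑ μ, MvPolynomial.X μ) ^ (Fintype.card N - 1) *
            MvPolynomial.monomial (∑ μ, Finsupp.single μ 1) 1)) := by
    rw [← hdet, ← hones, mul_left_comm, hpoly, mul_assoc, Nat.cast_pow]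
  have hco := congrArg (MvPolynomial.coeff (D + ∑ μ, Finsupp.single μ 1)) hmain
  simp only [← map_natCast (MvPolynomial.C : ℚ →+* MvPolynomial M ℚ),
    MvPolynomial.coeff_C_mul, MvPolynomial.coeff_mul_monomial, MvPolynomial.coeff_sum] at hco
  have hDsum : D.sum (fun _ k => k) = Fintype.card N - 1 := by
    rw [Finsupp.sum_fintype _ _ (fun _ => rfl), hd]
    simp [D]
  rw [MvPolynomial.coeff_sum_X_pow_of_fintype, if_pos hDsum,
    Finsupp.multinomial_eq_of_support_subset (Finset.subset_univ _)] at hco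
  have hmult : (∏ μ, (d μ).factorial) * Nat.multinomial Finset.univ D =
      (Fintype.card N - 1).factorial := by
    have := Nat.multinomial_spec Finset.univ d
    rw [show Fintype.card N - 1 = ∑ μ, d μ by omega, ← this]
    rfl
  have hsum : ∑ f : M ⊕ {ν : N // ν ≠ ν₀} → M × N, MvPolynomial.coeff (D + ∑ μ, Finsupp.single μ 1)
      (if EdgeConnected (fun a => (Sum.inl (f a).1 : M ⊕ N)) (fun a => Sum.inr (f a).2) then
          MvPolynomial.monomial (∑ a, Finsupp.single (f a).1 1) (1 : ℚ) else 0) =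
      (Finset.univ.filter fun f : M ⊕ {ν : N // ν ≠ ν₀} → M × N =>
      EdgeConnected (fun a => (Sum.inl (f a).1 : M ⊕ N)) (fun a => Sum.inr (f a).2) ∧
        ∀ μ, (Finset.univ.filter fun a => (f a).1 = μ).card = d μ + 1).card := by
    rw [Finset.card_filter, Nat.cast_sum]
    refine Finset.sum_congr rfl fun f _ => ?_
    have hiff : (∑ a, Finsupp.single (f a).1 1 = D + ∑ μ, Finsupp.single μ 1) ↔
        ∀ μ, (Finset.univ.filter fun a => (f a).1 = μ).card = d μ + 1 := by
      rw [Finsupp.ext_iff]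
      refine forall_congr' fun μ => ?_
      simp [Finsupp.finsetSum_apply, Finsupp.single_apply, D, -Fintype.sum_sum_type]
    by_cases hc : EdgeConnected (fun a => (Sum.inl (f a).1 : M ⊕ N)) (fun a => Sum.inr (f a).2)
    · simp only [hc, if_true, true_and, MvPolynomial.coeff_monomial, hiff]
      split_ifs <;> simp
    · simp [hc]
  rw [hsum, mul_one] at hco
  norm_cast at hco
  rw [← hmult, hco]
  ring

/-! ### Counting spanning trees with prescribed degrees. -/

/-- A set of edges of the complete bipartite graph on `M` and `N` that connects all vertices. -/
def BipartiteConnected {M N : Type*} (T : Finset (M × N)) : Prop :=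
  EdgeConnected (fun e : T => (Sum.inl e.1.1 : M ⊕ N)) (fun e => Sum.inr e.1.2)

theorem BipartiteConnected.card_le {M N : Type*} [Fintype M] [Fintype N] {T : Finset (M × N)}
    (hT : BipartiteConnected T) : Fintype.card M + Fintype.card N ≤ T.card + 1 := by
  simpa using EdgeConnected.card_le hT

theorem edgeConnected_iff_image {M N α : Type*} [Fintype α] [DecidableEq (M × N)]
    (f : α → M × N) :
    EdgeConnected (fun a => (Sum.inl (f a).1 : M ⊕ N)) (fun a => Sum.inr (f a).2) ↔
      BipartiteConnected (Finset.univ.image f) := by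
  refine forall_congr' fun s => imp_congr_left ⟨fun h e => ?_, fun h a => ?_⟩
  · obtain ⟨a, _, ha⟩ := Finset.mem_image.1 e.2
    simpa [ha] using h a
  · exact h ⟨f a, Finset.mem_image_of_mem f (Finset.mem_univ a)⟩

theorem card_filter_image_eq {α β : Type*} [Fintype α] [DecidableEq α] [Fintype β]
    [DecidableEq β] {T : Finset β}
    (hT : T.card = Fintype.card α) :
    (Finset.univ.filter fun f : α → β => Finset.univ.image f = T).card =
      (Fintype.card α).factorial := by
  have e : α ≃ T := Fintype.equivOfCardEq (by simp [hT])
  rw [← Fintype.card_equiv e, ← Finset.card_univ]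
  symm
  refine Finset.card_bij (fun g _ a => (g a : β)) (fun g _ => ?_) (fun g _ g' _ h => ?_)
    fun f hf => ?_
  · simp only [Finset.mem_filter, Finset.mem_univ, true_and]
    ext b
    simp only [Finset.mem_image, Finset.mem_univ, true_and]
    exact ⟨fun ⟨a, ha⟩ => ha ▸ (g a).2, fun hb => ⟨g.symm ⟨b, hb⟩, by simp⟩⟩
  · ext a
    exact congrFun h a
  · simp only [Finset.mem_filter, Finset.mem_univ, true_and] at hf
    have hmem (a : α) : f a ∈ T := hf ▸ Finset.mem_image_of_mem f (Finset.mem_univ a)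
    have hsurj : Function.Surjective fun a => (⟨f a, hmem a⟩ : T) := by
      rintro ⟨b, hb⟩
      rw [← hf] at hb
      obtain ⟨a, _, ha⟩ := Finset.mem_image.1 hb
      exact ⟨a, Subtype.ext ha⟩
    exact ⟨Equiv.ofBijective _ ((Fintype.bijective_iff_surjective_and_card _).2
      ⟨hsurj, by simp [hT]⟩), Finset.mem_univ _, rfl⟩

open Classical in
/-- The spanning trees of the complete bipartite graph on `M` and `N` in which `μ ∈ M` has degree
`d μ + 1`. -/
noncomputable def degreeTrees {M : Type*} (N : Type*) [Fintype M] [Fintype N] (d : M → ℕ) :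
    Finset (Finset (M × N)) :=
  Finset.univ.filter fun T => BipartiteConnected T ∧ T.card + 1 = Fintype.card M + Fintype.card N ∧
    ∀ μ, (T.filter fun e => e.1 = μ).card = d μ + 1

theorem card_degreeTrees {M N : Type*} [Fintype M] [Fintype N]
    (d : M → ℕ) (hd : Fintype.card N = 1 + ∑ μ, d μ) :
    Fintype.card N * (degreeTrees N d).card * ∏ μ, (d μ).factorial =
      Fintype.card N ^ Fintype.card M * (Fintype.card N - 1).factorial := by
  classical
  obtain ⟨ν₀⟩ : Nonempty N := Fintype.card_pos_iff.1 (by omega)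
  have hr : Fintype.card (M ⊕ {ν : N // ν ≠ ν₀}) + 1 = Fintype.card M + Fintype.card N := by
    rw [Fintype.card_sum, Fintype.card_subtype_compl, Fintype.card_subtype_eq]
    omega
  have h := card_mul_card_connected_sequences ν₀ d hd
  have hfib := Finset.card_eq_sum_card_fiberwise
    (s := Finset.univ.filter fun f : M ⊕ {ν : N // ν ≠ ν₀} → M × N =>
      EdgeConnected (fun a => (Sum.inl (f a).1 : M ⊕ N)) (fun a => Sum.inr (f a).2) ∧
        ∀ μ, (Finset.univ.filter fun a => (f a).1 = μ).card = d μ + 1)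
    (f := fun f => Finset.univ.image f) (t := degreeTrees N d) (by
      intro f hf
      simp only [Finset.coe_filter, Finset.mem_univ, true_and, Set.mem_ofPred_eq] at hf
      rw [edgeConnected_iff_image] at hf
      have h1 := hf.1.card_le
      have h2 := Finset.card_image_le (s := Finset.univ) (f := f)
      rw [Finset.card_univ] at h2
      -- A connected edge set has at least m + n - 1 elements, the length of the sequence, so no
      -- edge is repeated. Each tree therefore arises from (m + n - 1)! sequences.
      have hinj : Function.Injective f := by
        have h3 : (Finset.univ.image f).card =
            (Finset.univ : Finset (M ⊕ {ν : N // ν ≠ ν₀})).card := by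
          rw [Finset.card_univ]
          omega
        rw [← Set.injOn_univ]
        simpa using Finset.card_image_iff.1 h3
      simp only [degreeTrees, Finset.coe_filter, Finset.mem_univ, true_and, Set.mem_ofPred_eq]
      refine ⟨hf.1, by omega, fun μ => ?_⟩
      rw [Finset.filter_image, Finset.card_image_of_injective _ hinj, hf.2])
  have hfib' : ∀ T ∈ degreeTrees N d, ((Finset.univ.filter fun f : M ⊕ {ν : N // ν ≠ ν₀} → M × N =>
      EdgeConnected (fun a => (Sum.inl (f a).1 : M ⊕ N)) (fun a => Sum.inr (f a).2) ∧
        ∀ μ, (Finset.univ.filter fun a => (f a).1 = μ).card = d μ + 1).filter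
          fun f => Finset.univ.image f = T).card =
            (Fintype.card (M ⊕ {ν : N // ν ≠ ν₀})).factorial := by
    intro T hT
    simp only [degreeTrees, Finset.mem_filter, Finset.mem_univ, true_and] at hT
    have hc : T.card = Fintype.card (M ⊕ {ν : N // ν ≠ ν₀}) := by omega
    rw [← card_filter_image_eq hc, Finset.filter_filter]
    congr 1
    ext f
    simp only [Finset.mem_filter, Finset.mem_univ, true_and]
    refine ⟨fun h => h.2, fun h => ⟨?_, h⟩⟩
    subst h
    refine ⟨(edgeConnected_iff_image f).2 hT.1, fun μ => ?_⟩
    rw [← hT.2.2 μ, Finset.filter_image, Finset.card_image_of_injOn]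
    exact (Finset.card_image_iff.1 (by rw [hc, Finset.card_univ])).mono (Finset.subset_univ _)
  rw [hfib, Finset.sum_congr rfl hfib', Finset.sum_const, smul_eq_mul] at h
  refine Nat.eq_of_mul_eq_mul_left
    (Nat.factorial_pos (Fintype.card (M ⊕ {ν : N // ν ≠ ν₀}))) ?_
  rw [← h]
  ring

/-! ### Vertices and edges of `P_d` through spanning trees. -/

/-- The linear map sending `x ∈ ℝ^(M × N)` to its row sums and to its negated column sums. -/
noncomputable def bipartiteBoundary (M N : Type*) [Fintype M] [Fintype N] :
    (M × N → ℝ) →ₗ[ℝ] (M ⊕ N → ℝ) :=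
  boundary (fun e => Sum.inl e.1) (fun e => Sum.inr e.2)

/-- The supplies and negated demands of the polytope `P_d`. -/
def degreeSupply {M : Type*} (N : Type*) [Fintype M] (d : M → ℤ) : M ⊕ N → ℝ :=
  Sum.elim (fun μ => 1 + (Fintype.card M : ℝ) * (d μ : ℝ)) (fun _ => -(Fintype.card M : ℝ))

section Transportation

variable {M N : Type*}

theorem edgeConnected_completeBipartite [Nonempty M] [Nonempty N] :
    EdgeConnected (fun e : M × N => (Sum.inl e.1 : M ⊕ N)) (fun e => Sum.inr e.2) := by
  intro s hs
  obtain ⟨μ₀⟩ := ‹Nonempty M›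
  obtain ⟨ν₀⟩ := ‹Nonempty N›
  by_cases h : Sum.inl μ₀ ∈ s
  · right
    have hN (ν : N) : Sum.inr ν ∈ s := (hs (μ₀, ν)).1 h
    refine Set.eq_univ_of_forall ?_
    rintro (μ | ν)
    · exact (hs (μ, ν₀)).2 (hN ν₀)
    · exact hN ν
  · left
    have hN (ν : N) : Sum.inr ν ∉ s := fun h' => h ((hs (μ₀, ν)).2 h')
    refine Set.eq_empty_of_forall_notMem ?_
    rintro (μ | ν)
    · exact fun h' => hN ν₀ ((hs (μ, ν₀)).1 h')
    · exact hN ν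

variable [Fintype M]

theorem sum_degreeSupply_mem (d : M → ℤ) (s : Finset (M ⊕ N)) :
    ∑ v ∈ s, degreeSupply N d v =
      s.toLeft.card + (Fintype.card M : ℝ) * (∑ μ ∈ s.toLeft, (d μ : ℝ) - s.toRight.card) := by
  conv_lhs => rw [← Finset.toLeft_disjSum_toRight (u := s), Finset.sum_disjSum]
  simp [degreeSupply, Finset.sum_add_distrib, ← Finset.mul_sum]
  ring

variable [Fintype N]

theorem bipartiteBoundary_inl (x : M × N → ℝ) (μ : M) :
    bipartiteBoundary M N x (Sum.inl μ) = ∑ ν, x (μ, ν) := by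
  classical
  simp [bipartiteBoundary, boundary_apply, Fintype.sum_prod_type_right]

theorem bipartiteBoundary_inr (x : M × N → ℝ) (ν : N) :
    bipartiteBoundary M N x (Sum.inr ν) = -∑ μ, x (μ, ν) := by
  classical
  simp [bipartiteBoundary, boundary_apply, Fintype.sum_prod_type]

theorem bipartiteBoundary_eq_degreeSupply_iff {x : M × N → ℝ} {d : M → ℤ} :
    bipartiteBoundary M N x = degreeSupply N d ↔
      (∀ μ, ∑ ν, x (μ, ν) = 1 + (Fintype.card M : ℝ) * (d μ : ℝ)) ∧
        ∀ ν, ∑ μ, x (μ, ν) = Fintype.card M := by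
  rw [funext_iff, Sum.forall]
  simp only [bipartiteBoundary_inl, bipartiteBoundary_inr, degreeSupply, Sum.elim_inl,
    Sum.elim_inr, neg_inj]

theorem degreePolytope_eq_standardPolytope (d : M → ℕ) :
    degreePolytope N d =
      standardPolytope (bipartiteBoundary M N) (degreeSupply N fun μ => (d μ : ℤ)) := by
  ext x
  simp only [degreePolytope, transportationPolytope, standardPolytope, Set.mem_ofPred_eq,
    bipartiteBoundary_eq_degreeSupply_iff, Int.cast_natCast]

theorem isCompact_degreePolytope (d : M → ℕ) : IsCompact (degreePolytope N d) := by
  refine (isCompact_Icc (a := (0 : M × N → ℝ)) (b := fun _ => (Fintype.card M : ℝ))).of_isClosed_subset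
    ?_ ?_
  · rw [degreePolytope_eq_standardPolytope]
    refine IsClosed.inter ?_ ?_
    · exact isClosed_Ici (a := (0 : M × N → ℝ))
    · exact isClosed_singleton.preimage (bipartiteBoundary M N).continuous_of_finiteDimensional
  · rintro x ⟨hx0, _, hx⟩
    refine ⟨hx0, fun e => ?_⟩
    rw [← hx e.2]
    exact Finset.single_le_sum (f := fun μ => x (μ, e.2)) (fun μ _ => hx0 _) (Finset.mem_univ e.1)

theorem sum_bipartiteBoundary_mem [DecidableEq M] [DecidableEq N] (x : M × N → ℝ)
    (s : Finset (M ⊕ N)) : ∑ v ∈ s, bipartiteBoundary M N x v =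
      ∑ e, x e * ((if Sum.inl e.1 ∈ s then 1 else 0) - (if Sum.inr e.2 ∈ s then 1 else 0)) := by
  have := sum_mul_boundary (fun e : M × N => (Sum.inl e.1 : M ⊕ N)) (fun e => Sum.inr e.2)
    (fun v => if v ∈ s then 1 else 0) x
  rw [← this]
  simp [bipartiteBoundary]

theorem boundary_restrict {T : Finset (M × N)} {x : M × N → ℝ} (hx : ∀ e, e ∉ T → x e = 0) :
    boundary (fun e : T => (Sum.inl e.1.1 : M ⊕ N)) (fun e => Sum.inr e.1.2) (fun e => x e.1) =
      bipartiteBoundary M N x := by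
  classical
  ext v
  rw [bipartiteBoundary, boundary_apply, boundary_apply,
    ← Finset.sum_subset (Finset.subset_univ T) fun e _ he => by simp [hx e he],
    ← Finset.sum_coe_sort T]

theorem BipartiteConnected.exists_flow {T : Finset (M × N)} (hT : BipartiteConnected T)
    {b : M ⊕ N → ℝ} (hb : ∑ v, b v = 0) :
    ∃ x, (∀ e, e ∉ T → x e = 0) ∧ bipartiteBoundary M N x = b := by
  classical
  obtain ⟨y, hy⟩ := EdgeConnected.exists_boundary_eq hT hb
  have h0 (e) (he : e ∉ T) : (fun e => if h : e ∈ T then y ⟨e, h⟩ else 0) e = 0 := by simp [he]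
  refine ⟨fun e => if h : e ∈ T then y ⟨e, h⟩ else 0, h0, ?_⟩
  rw [← boundary_restrict h0, ← hy]
  congr 1
  ext e
  simp

/-- The points supported on a connected graph have no freedom iff the graph is a tree. -/
theorem BipartiteConnected.kerVanishing_eq_bot_iff [Nonempty M] {T : Finset (M × N)}
    (hT : BipartiteConnected T) :
    kerVanishing (bipartiteBoundary M N) {e | e ∉ T} = ⊥ ↔
      T.card + 1 = Fintype.card M + Fintype.card N := by
  classical
  have hk := EdgeConnected.finrank_ker_boundary hT
  rw [Fintype.card_sum, Fintype.card_coe] at hk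
  constructor
  · intro h
    have : LinearMap.ker (boundary (fun e : T => (Sum.inl e.1.1 : M ⊕ N))
        (fun e => Sum.inr e.1.2)) = ⊥ := by
      rw [LinearMap.ker_eq_bot']
      intro y hy
      have h0 (e) (he : e ∉ T) : (fun e => if h : e ∈ T then y ⟨e, h⟩ else 0) e = 0 := by simp [he]
      have hmem : (fun e => if h : e ∈ T then y ⟨e, h⟩ else 0) ∈
          kerVanishing (bipartiteBoundary M N) {e | e ∉ T} := by
        refine ⟨?_, h0⟩
        rw [← boundary_restrict h0, ← hy]
        congr 1
        ext e
        simp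
      rw [h, Submodule.mem_bot] at hmem
      ext e
      simpa using congrFun hmem e.1
    rw [this, finrank_bot] at hk
    omega
  · intro hc
    rw [Submodule.eq_bot_iff]
    rintro w ⟨hw, hw0⟩
    have hinj := EdgeConnected.boundary_injective hT (by simpa using hc)
    have h0 : (fun e : T => w e.1) = 0 := by
      apply hinj
      rw [boundary_restrict hw0, hw, map_zero]
    ext e
    by_cases he : e ∈ T
    · exact congrFun h0 ⟨e, he⟩
    · exact hw0 e he

/-- The support of a point of `P_d` is connected, as partial sums of the supplies are not divisible
by `|M|`. -/
theorem bipartiteConnected_support [Nonempty M] [DecidableEq (M × N)] {d : M → ℕ}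
    (hd : Fintype.card N = 1 + ∑ μ, d μ) {x : M × N → ℝ}
    (hx : bipartiteBoundary M N x = degreeSupply N fun μ => (d μ : ℤ)) :
    BipartiteConnected (Finset.univ.filter fun e => x e ≠ 0) := by
  classical
  intro s hs
  have hs' (e) (he : x e ≠ 0) : Sum.inl e.1 ∈ s ↔ Sum.inr e.2 ∈ s := hs ⟨e, by simpa using he⟩
  have h0 : ∑ v ∈ s.toFinset, bipartiteBoundary M N x v = 0 := by
    rw [sum_bipartiteBoundary_mem]
    refine Finset.sum_eq_zero fun e _ => ?_
    by_cases he : x e = 0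
    · simp [he]
    · simp [hs' e he]
  rw [hx, sum_degreeSupply_mem] at h0
  set A := s.toFinset.toLeft with hA
  set C := s.toFinset.toRight with hC
  have hm : 0 < Fintype.card M := Fintype.card_pos
  -- No flow crosses the boundary of `s`, so its net supply is zero. Modulo m this forces |A| to be
  -- 0 or m, and then |C| is 0 or n.
  have h1 : A.card + Fintype.card M * ∑ μ ∈ A, d μ = Fintype.card M * C.card := by
    have : (A.card : ℝ) + Fintype.card M * ∑ μ ∈ A, (d μ : ℝ) = Fintype.card M * C.card := by
      simp only [Int.cast_natCast] at h0
      linarith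
    exact_mod_cast this
  have hdvd : Fintype.card M ∣ A.card :=
    (Nat.dvd_add_left (dvd_mul_right _ _)).1 (h1 ▸ dvd_mul_right _ _)
  have hmemA (μ : M) : μ ∈ A ↔ Sum.inl μ ∈ s := by simp [hA]
  have hmemC (ν : N) : ν ∈ C ↔ Sum.inr ν ∈ s := by simp [hC]
  rcases Nat.eq_zero_or_pos A.card with hA0 | hA0
  · have hAe : A = ∅ := Finset.card_eq_zero.1 hA0
    have hCe : C = ∅ := by
      rw [← Finset.card_eq_zero]
      simpa [hAe, hm.ne'] using h1
    left
    ext (μ | ν)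
    · simp [← hmemA, hAe]
    · simp [← hmemC, hCe]
  · have hAm : A.card = Fintype.card M := le_antisymm A.card_le_univ (Nat.le_of_dvd hA0 hdvd)
    have hAu : A = Finset.univ := (Finset.card_eq_iff_eq_univ A).1 hAm
    have hCu : C = Finset.univ := by
      rw [← Finset.card_eq_iff_eq_univ, hd]
      rw [hAm, hAu] at h1
      refine Nat.eq_of_mul_eq_mul_left hm ?_
      rw [← h1]
      ring
    right
    ext (μ | ν)
    · simp [← hmemA, hAu]
    · simp [← hmemC, hCu]

/-- The flow through an edge of a spanning tree, in terms of the deviations between the supplies and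
the degrees of the tree on one side of the edge. -/
theorem BipartiteConnected.exists_flow_formula [DecidableEq M] {T : Finset (M × N)}
    (hT : BipartiteConnected T) (hcard : T.card + 1 = Fintype.card M + Fintype.card N)
    {e₀ : M × N} (he₀ : e₀ ∈ T) :
    ∃ S : Finset M, S.Nonempty ∧ ∀ (d : M → ℤ) (x : M × N → ℝ), (∀ e, e ∉ T → x e = 0) →
      bipartiteBoundary M N x = degreeSupply N d → x e₀ = S.card + (Fintype.card M : ℝ) *
        ((∑ μ ∈ S, (d μ + 1 - (T.filter fun e => e.1 = μ).card) : ℤ) : ℝ) := by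
  classical
  obtain ⟨s, hs, hh, ht, hsc⟩ := EdgeConnected.exists_cut hT (by simpa using hcard) ⟨e₀, he₀⟩
  -- The edges of `T` whose source lies in `s` are as many as the vertices of `s`. This trades the
  -- number of sinks in `s` for tree degrees in the supply formula.
  have hdeg : ∑ μ ∈ s.toLeft, (T.filter fun e => e.1 = μ).card =
      s.toLeft.card + s.toRight.card := by
    have h1 := Finset.card_eq_sum_card_fiberwise (s := T.filter fun e => Sum.inl e.1 ∈ s)
      (t := s.toLeft) (f := Prod.fst) (by intro e he; simpa using (Finset.mem_filter.1 he).2)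
    have h2 : s.card = (T.filter fun e => Sum.inl e.1 ∈ s).card := by
      rw [← hsc, ← Finset.card_map (Function.Embedding.subtype _)]
      congr 1
      ext e
      simp [and_comm]
    rw [Finset.card_toLeft_add_card_toRight, h2, h1]
    refine Finset.sum_congr rfl fun μ hμ => ?_
    rw [Finset.filter_filter]
    congr 1
    ext e
    simp only [Finset.mem_filter, and_congr_right_iff]
    intro _
    constructor
    · rintro rfl
      exact ⟨by simpa using hμ, rfl⟩
    · exact fun h => h.2
  refine ⟨s.toLeft, ⟨e₀.1, by simpa using hh⟩, fun d x hx0 hx => ?_⟩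
  have hflow : ∑ v ∈ s, bipartiteBoundary M N x v = x e₀ := by
    rw [sum_bipartiteBoundary_mem, Finset.sum_eq_single e₀]
    · simp [show Sum.inl e₀.1 ∈ s from hh, show Sum.inr e₀.2 ∉ s from ht]
    · intro e _ hne
      by_cases he : e ∈ T
      · have := hs ⟨e, he⟩ fun h => hne (congrArg Subtype.val h)
        simp only [this, sub_self, mul_zero]
      · simp [hx0 e he]
    · simp
  rw [← hflow, hx, sum_degreeSupply_mem]
  have hdeg' : (∑ μ ∈ s.toLeft, ((T.filter fun e => e.1 = μ).card : ℝ)) =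
      s.toLeft.card + s.toRight.card := by exact_mod_cast hdeg
  push_cast
  rw [Finset.sum_sub_distrib, Finset.sum_add_distrib, hdeg', Finset.sum_const,
    nsmul_eq_mul]
  ring

theorem card_filter_fst_eq_of_mem_degreePolytope [Nonempty M] [DecidableEq M] {d : M → ℕ}
    {x : M × N → ℝ} (hxP : ∀ e, 0 ≤ x e) {T : Finset (M × N)}
    (hx : bipartiteBoundary M N x = degreeSupply N fun μ => (d μ : ℤ)) (hxT : ∀ e, e ∈ T ↔ x e ≠ 0)
    (hT : BipartiteConnected T) (hcard : T.card + 1 = Fintype.card M + Fintype.card N) (μ : M) :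
    (T.filter fun e => e.1 = μ).card = d μ + 1 := by
  classical
  have hm : 0 < (Fintype.card M : ℝ) := by exact_mod_cast Fintype.card_pos
  -- The supply parameters for which `T` has the required degrees. The flow `y` on `T` with these
  -- supplies has the value |S| on each edge and is compared with `x`.
  set δ : M → ℤ := fun μ => ((T.filter fun e => e.1 = μ).card : ℤ) - 1 with hδ
  have hsum : ∑ v, degreeSupply N δ v = 0 := by
    have h1 := sum_degreeSupply_mem δ (Finset.univ : Finset (M ⊕ N))
    have h2 : ∑ μ, (δ μ : ℝ) = (T.card : ℝ) - Fintype.card M := by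
      simp only [hδ]
      push_cast
      rw [Finset.sum_sub_distrib]
      have := Finset.card_eq_sum_card_fiberwise (s := T) (t := Finset.univ) (f := Prod.fst) (by simp)
      rw [this]
      simp
    have h3 : (T.card : ℝ) + 1 = Fintype.card M + Fintype.card N := by exact_mod_cast hcard
    rw [h1]
    have e1 : (Finset.univ : Finset (M ⊕ N)).toLeft = Finset.univ := by ext; simp
    have e2 : (Finset.univ : Finset (M ⊕ N)).toRight = Finset.univ := by ext; simp
    rw [e1, e2, h2, Finset.card_univ, Finset.card_univ]
    rw [← eq_sub_iff_add_eq] at h3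
    rw [h3]
    ring
  have hx0 (e) (he : e ∉ T) : x e = 0 := by
    by_contra h
    exact he ((hxT e).2 h)
  obtain ⟨y, hy0, hy⟩ := hT.exists_flow hsum
  have hle (e) : y e ≤ x e := by
    by_cases he : e ∈ T
    · obtain ⟨S, _, hS⟩ := hT.exists_flow_formula hcard he
      have hxe := hS _ x hx0 hx
      have hye := hS _ y hy0 hy
      have hpos : 0 < x e := lt_of_le_of_ne (hxP e) ((hxT e).1 he).symm
      set k : ℤ := ∑ μ ∈ S, ((d μ : ℤ) + 1 - (T.filter fun e => e.1 = μ).card)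
      -- Since |S| ≤ m, the flow |S| + m k can be positive only if the integer k exceeds -1. So k ≥
      -- 0 and the flow is at least |S|, the value of `y`.
      have hk : -1 < k := by
        have hSm : (S.card : ℝ) ≤ Fintype.card M := by exact_mod_cast S.card_le_univ
        have : (-1 : ℝ) < k := by
          by_contra! hk
          nlinarith
        exact_mod_cast this
      have hk' : (0 : ℝ) ≤ k := by exact_mod_cast (by omega : 0 ≤ k)
      rw [hxe, hye]
      have : ∑ μ ∈ S, (δ μ + 1 - ((T.filter fun e => e.1 = μ).card : ℤ)) = 0 :=
        Finset.sum_eq_zero fun μ _ => by simp [hδ]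
      rw [this, Int.cast_zero, mul_zero, add_zero]
      have := mul_nonneg hm.le hk'
      linarith
    · rw [hx0 e he, hy0 e he]
  rw [bipartiteBoundary_eq_degreeSupply_iff] at hx hy
  -- Both flows have all column sums m, so the inequality `y ≤ x` is an equality, and comparing row
  -- sums gives `d = δ`.
  have hxy (e : M × N) : y e = x e := by
    have h1 : ∑ μ, y (μ, e.2) = ∑ μ, x (μ, e.2) := by rw [hx.2, hy.2]
    exact (Finset.sum_eq_sum_iff_of_le fun μ _ => hle (μ, e.2)).1 h1 e.1 (Finset.mem_univ _)
  have h1 := hx.1 μ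
  have h2 := hy.1 μ
  simp only [hxy] at h2
  rw [h1, add_right_inj, mul_right_inj' hm.ne'] at h2
  have h3 : (d μ : ℤ) = δ μ := by exact_mod_cast h2
  simp only [hδ] at h3
  omega

/-- Taking supports is the bijection. It is injective because a vertex is the only point of the
polytope vanishing at its zeros. -/
theorem ncard_extremePoints_degreePolytope [Nonempty M] {d : M → ℕ}
    (hd : Fintype.card N = 1 + ∑ μ, d μ) :
    ((degreePolytope N d).extremePoints ℝ).ncard = (degreeTrees N d).card := by
  classical
  rw [degreePolytope_eq_standardPolytope, ← Set.ncard_coe_finset]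
  let supp (x : M × N → ℝ) : Finset (M × N) := Finset.univ.filter fun e => x e ≠ 0
  have hsupp (x : M × N → ℝ) : {e | x e = 0} = {e | e ∉ supp x} := by ext e; simp [supp]
  have himg : (degreeTrees N d : Set (Finset (M × N))) = supp ''
      (standardPolytope (bipartiteBoundary M N) (degreeSupply N fun μ => (d μ : ℤ))).extremePoints
        ℝ := by
    ext T
    simp only [degreeTrees, Finset.coe_filter, Finset.mem_univ, true_and, Set.mem_ofPred_eq]
    constructor
    · rintro ⟨hT, hcard, hdeg⟩
      have hsum : ∑ v, degreeSupply N (fun μ => (d μ : ℤ)) v = 0 := by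
        simp [degreeSupply, Finset.sum_add_distrib, ← Finset.mul_sum, hd]
        ring
      obtain ⟨x, hx0, hx⟩ := hT.exists_flow hsum
      have hpos (e) (he : e ∈ T) : 0 < x e := by
        obtain ⟨S, hS, h⟩ := hT.exists_flow_formula hcard he
        rw [h _ x hx0 hx, Finset.sum_eq_zero fun μ _ => by simp [hdeg]]
        simpa using hS
      have hxT : supp x = T := by
        ext e
        simp only [supp, Finset.mem_filter, Finset.mem_univ, true_and]
        exact ⟨fun h => by_contra fun he => h (hx0 e he), fun he => (hpos e he).ne'⟩
      refine ⟨x, mem_extremePoints_standardPolytope_iff.2 ⟨⟨fun e => ?_, hx⟩, ?_⟩, hxT⟩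
      · by_cases he : e ∈ T
        · exact (hpos e he).le
        · exact (hx0 e he).ge
      · rw [hsupp, hxT]
        exact hT.kerVanishing_eq_bot_iff.2 hcard
    · rintro ⟨x, hx, rfl⟩
      obtain ⟨⟨hx0, hxb⟩, hk⟩ := mem_extremePoints_standardPolytope_iff.1 hx
      have hconn : BipartiteConnected (supp x) := bipartiteConnected_support hd hxb
      rw [hsupp, hconn.kerVanishing_eq_bot_iff] at hk
      exact ⟨hconn, hk, card_filter_fst_eq_of_mem_degreePolytope hx0 hxb (by simp [supp])
        hconn hk⟩
  rw [himg, Set.InjOn.ncard_image]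
  intro x hx y hy hxy
  have hy' := mem_zeroFace_zeros (mem_extremePoints_standardPolytope_iff.1 hy).1
  rw [hsupp, ← show supp x = supp y from hxy, ← hsupp, zeroFace_zeros_eq_singleton hx] at hy'
  exact hy'.symm

theorem finrank_ker_bipartiteBoundary [Nonempty M] [Nonempty N] :
    Module.finrank ℝ (LinearMap.ker (bipartiteBoundary M N)) + Fintype.card M + Fintype.card N =
      Fintype.card M * Fintype.card N + 1 := by
  have := (edgeConnected_completeBipartite (M := M) (N := N)).finrank_ker_boundary
  rwa [Fintype.card_sum, Fintype.card_prod, ← add_assoc] at this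

/-- The polytope is simple: vertices are supported on spanning trees, so the number of zero
coordinates is mn - (m + n - 1), the dimension of the kernel. -/
theorem ncard_edges_degreePolytope [Nonempty M] {d : M → ℕ}
    (hd : Fintype.card N = 1 + ∑ μ, d μ) :
    (degreeTrees N d).card * Module.finrank ℝ (LinearMap.ker (bipartiteBoundary M N)) =
      (facesOfDim (degreePolytope N d) 1).ncard * 2 := by
  classical
  have : Nonempty N := Fintype.card_pos_iff.1 (by omega)
  rw [← ncard_extremePoints_degreePolytope hd]
  have hc := isCompact_degreePolytope (N := N) d
  rw [degreePolytope_eq_standardPolytope] at hc ⊢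
  refine two_mul_ncard_edges hc fun x hx => ?_
  obtain ⟨⟨hx0, hxb⟩, hk⟩ := mem_extremePoints_standardPolytope_iff.1 hx
  have hconn := bipartiteConnected_support hd hxb
  have hsupp : {e | x e = 0} = {e | e ∉ Finset.univ.filter fun e => x e ≠ 0} := by ext e; simp
  rw [hsupp, hconn.kerVanishing_eq_bot_iff] at hk
  have h1 := Finset.card_filter_add_card_filter_not (s := Finset.univ) (fun e => x e ≠ 0)
  have h2 := finrank_ker_bipartiteBoundary (M := M) (N := N)
  simp only [not_not, Finset.card_univ, Fintype.card_prod] at h1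
  rw [Nat.card_eq_fintype_card, Fintype.card_subtype]
  omega

end Transportation

/-! ### The two face numbers. -/

theorem mainTheorem6 {M N : Type*} [Fintype M] [Fintype N] (d : M → ℕ) (m n : ℕ)
    (hm : Fintype.card M = m) (hn : Fintype.card N = n) (hd : n = 1 + ∑ μ, d μ) :
    ((facesOfDim (degreePolytope N d) 0).Finite ∧
      ((facesOfDim (degreePolytope N d) 0).ncard : ℚ) =
        ((n - 1).factorial : ℚ) * (n : ℚ) ^ ((m : ℤ) - 1) / ∏ μ, ((d μ).factorial : ℚ)) ∧
    ((facesOfDim (degreePolytope N d) 1).Finite ∧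
      ((facesOfDim (degreePolytope N d) 1).ncard : ℚ) =
        ((m : ℚ) - 1) * ((n : ℚ) - 1) * ((n - 1).factorial : ℚ) * (n : ℚ) ^ ((m : ℤ) - 1) /
          (2 * ∏ μ, ((d μ).factorial : ℚ))) := by
  subst hm hn
  have hfin (k : ℕ) : (facesOfDim (degreePolytope N d) k).Finite := by
    rw [degreePolytope_eq_standardPolytope]
    exact finite_facesOfDim_standardPolytope k
  have h0 : (facesOfDim (degreePolytope N d) 0).ncard =
      ((degreePolytope N d).extremePoints ℝ).ncard := by
    rw [degreePolytope_eq_standardPolytope, ncard_facesOfDim_zero_standardPolytope]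
  rcases isEmpty_or_nonempty M with hM | hM
  -- For m = 0 the polytope is the single point of a zero-dimensional space. The exponent m - 1 is
  -- then the integer -1, harmless as n = 1, and the factor n - 1 kills f_1.
  · have hn1 : Fintype.card N = 1 := by simpa using hd
    have huniv : degreePolytope N d = Set.univ := by
      refine Set.eq_univ_of_forall fun x => ⟨fun e => isEmptyElim e.1, isEmptyElim, fun ν => ?_⟩
      simp
    have h1 : facesOfDim (degreePolytope N d) 1 = ∅ := by
      refine Set.eq_empty_of_forall_notMem ?_
      rintro F ⟨_, _, hF⟩
      have := Module.finrank_zero_of_subsingleton (R := ℝ) (M := vectorSpan ℝ F)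
      omega
    refine ⟨⟨hfin 0, ?_⟩, hfin 1, ?_⟩
    · rw [h0, Set.extremePoints_eq_self, huniv, Set.ncard_univ]
      simp [hn1]
    · rw [h1]
      simp [hn1]
  · have hprod : (∏ μ, ((d μ).factorial : ℚ)) ≠ 0 :=
      Finset.prod_ne_zero_iff.2 fun μ _ => by exact_mod_cast (d μ).factorial_ne_zero
    have hn0 : (Fintype.card N : ℚ) ≠ 0 := by
      have : Fintype.card N ≠ 0 := by omega
      exact_mod_cast this
    have hN : Nonempty N := Fintype.card_pos_iff.1 (by omega)
    have ht : ((degreeTrees N d).card : ℚ) = ((Fintype.card N - 1).factorial : ℚ) *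
        (Fintype.card N : ℚ) ^ ((Fintype.card M : ℤ) - 1) / ∏ μ, ((d μ).factorial : ℚ) := by
      have h : (Fintype.card N : ℚ) * (degreeTrees N d).card * ∏ μ, ((d μ).factorial : ℚ) =
          (Fintype.card N : ℚ) ^ Fintype.card M * ((Fintype.card N - 1).factorial : ℚ) := by
        exact_mod_cast card_degreeTrees d hd
      rw [zpow_sub_one₀ hn0, zpow_natCast, eq_div_iff hprod]
      field_simp
      linarith
    refine ⟨⟨hfin 0, ?_⟩, hfin 1, ?_⟩
    · rw [h0, ncard_extremePoints_degreePolytope hd, ht]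
    · have h1 : ((degreeTrees N d).card : ℚ) *
          Module.finrank ℝ (LinearMap.ker (bipartiteBoundary M N)) =
            (facesOfDim (degreePolytope N d) 1).ncard * 2 := by
        exact_mod_cast ncard_edges_degreePolytope hd
      have h2 : (Module.finrank ℝ (LinearMap.ker (bipartiteBoundary M N)) : ℚ) +
          Fintype.card M + Fintype.card N = Fintype.card M * Fintype.card N + 1 := by
        exact_mod_cast finrank_ker_bipartiteBoundary (M := M) (N := N)
      have h3 : (Module.finrank ℝ (LinearMap.ker (bipartiteBoundary M N)) : ℚ) =
          ((Fintype.card M : ℚ) - 1) * ((Fintype.card N : ℚ) - 1) := by linarith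
      rw [h3, ht] at h1
      rw [eq_div_iff (by simpa using hprod)]
      field_simp at h1
      linarith
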